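/- Let $a>-1$, $b>-1$ be real with $a+b\ge-1$, put $\varepsilon=\frac{a+b+1}{2}\ge 0$, let $N>K\ge1$ be integers and $L=N-K+1$. For $n\ge 1$ let $\mathrm{Sign}^+_n$ be the set of integer tuples $\nu_1\ge\dots\ge\nu_n\ge0$. **The coefficients $\Lambda^N_K(\nu,\kappa)$.** Let $P_m$ ($m\ge0$) be the classical Jacobi polynomials, i.e. the orthogonal polynomials on $[-1,1]$ with weight $(1-x)^a(1+x)^b$. For $\nu\in\mathrm{Sign}^+_n$ set $$P_{\nu,n}(x_1,\dots,x_n)=\frac{\det[P_{\nu_i+n-i}(x_j)]_{i,j=1}^n}{\prod_{1\le i<j\le n}(x_i-x_j)},\qquad \widetilde P_{\nu,n}=\frac{P_{\nu,n}}{P_{\nu,n}(1,\dots,1)}.$$ For $\nu\in\mathrm{Sign}^+_N$ the numbers $\Lambda^N_K(\nu,\kappa)$, $\kappa\in\mathrm{Sign}^+_K$, are the coefficients of the finite expansion $$\widetilde P_{\nu,N}(x_1,\dots,x_K,1,\dots,1)=\sum_{\kappa\in\mathrm{Sign}^+_K}\Lambda^N_K(\nu,\kappa)\,\widetilde P_{\kappa,K}(x_1,\dots,x_K).$$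 **The rational functions.** For $\nu\in\mathrm{Sign}^+_N$, $\kappa\in\mathrm{Sign}^+_K$ and $k=0,1,2,\dots$ put $$F_N(t)=\prod_{i=1}^N\frac{t^2-(N-i+\varepsilon)^2}{t^2-(\nu_i+N-i+\varepsilon)^2},\qquad d_K(\kappa;\varepsilon)=\prod_{1\le i<j\le K}\frac{(\kappa_i+K-i+\varepsilon)^2-(\kappa_j+K-j+\varepsilon)^2}{(K-i+\varepsilon)^2-(K-j+\varepsilon)^2},$$ $$g_k(t)={}_4F_3\left[\begin{matrix}-k,\ k+2\varepsilon,\ L,\ L+a\\ -t+L+\varepsilon,\ t+L+\varepsilon,\ a+1\end{matrix}\,\Big|\,1\right]=\sum_{m=0}^{k}\frac{(-k)_m(k+2\varepsilon)_m(L)_m(L+a)_m}{(-t+L+\varepsilon)_m(t+L+\varepsilon)_m(a+1)_m\,m!},$$ where $(x)_m=x(x+1)\cdots(x+m-1)$. Let $\mathcal F(\varepsilon,L)$ be the complex vector space of even rational functions of $t\in\mathbb C$ that are regular at $t=\infty$ and whose only singularities are simple poles in the set $\{\pm(L+\varepsilon+m): m=0,1,2,\dots\}$. **Theorem B.** For every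 $\nu\in\mathrm{Sign}^+_N$ the expansion defining $\Lambda^N_K(\nu,\cdot)$ exists and is unique; the functions $g_0,g_1,g_2,\dots$ form a basis of $\mathcal F(\varepsilon,L)$; and $g_{K-j}F_N\in\mathcal F(\varepsilon,L)$ for all $\nu\in\mathrm{Sign}^+_N$ and $j=1,\dots,K$. Writing $(\phi:g_k)$ for the coefficient of $g_k$ in the expansion of $\phi\in\mathcal F(\varepsilon,L)$ in this basis, one has for all $\nu\in\mathrm{Sign}^+_N$ and $\kappa\in\mathrm{Sign}^+_K$ $$\frac{\Lambda^N_K(\nu,\kappa)}{d_K(\kappa;\varepsilon)}=\det\left[\bigl(g_{K-j}F_N:g_{\kappa_i+K-i}\bigr)\right]_{i,j=1}^K .$$ -/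

import Mathlib

noncomputable section

namespace JacobiBranching

/-! ### Positive signatures -/

/-- Positive signatures of length `N`: tuples `ν 0 ≥ ν 1 ≥ … ≥ ν (N-1) ≥ 0` of integers.
With 0-based indices, the number `N - i` of the 1-based convention is `(i.rev : ℕ)`. -/
abbrev PosSign (N : ℕ) : Type := {ν : Fin N → ℕ // Antitone ν}

/-- The shifted coordinates `n_i = ν_i + N - i`. -/
def PosSign.shifted {N : ℕ} (ν : PosSign N) (i : Fin N) : ℕ := ν.1 i + (i.rev : ℕ)

/-! ### Jacobi polynomials -/

/-- The inner product with weight `(1 - x)^a (1 + x)^b` on `[-1, 1]`. -/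
def jacobiInner (a b : ℝ) (p q : Polynomial ℝ) : ℝ :=
  ∫ x in (-1 : ℝ)..1, p.eval x * q.eval x * ((1 - x) ^ a * (1 + x) ^ b)

/-- The monic orthogonal polynomials for this inner product: the Gram–Schmidt
orthogonalization of `1, x, x ^ 2, …`. -/
def jacobiMonic (a b : ℝ) : ℕ → Polynomial ℝ
  | n => Polynomial.X ^ n - ∑ k : Fin n,
      Polynomial.C (jacobiInner a b (Polynomial.X ^ n) (jacobiMonic a b k) /
        jacobiInner a b (jacobiMonic a b k) (jacobiMonic a b k)) * jacobiMonic a b k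
termination_by n => n
decreasing_by all_goals exact k.isLt

/-- The classical Jacobi polynomial `P_n^{(a,b)}`, in the standard normalization
`P_n^{(a,b)}(1) = (a+1)_n / n!`. -/
def jacobiP (a b : ℝ) (n : ℕ) : Polynomial ℝ :=
  Polynomial.C ((ascPochhammer ℝ n).eval (a + 1) / (n.factorial : ℝ) /
    (jacobiMonic a b n).eval 1) * jacobiMonic a b n

/-- `∏_{i<j} (x_i - x_j)`. -/
def vandermondePoly (N : ℕ) : MvPolynomial (Fin N) ℝ :=
  ∏ p : Fin N × Fin N with p.1 < p.2, (MvPolynomial.X p.1 - MvPolynomial.X p.2)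

/-- `det [P_{n_i}(x_j)]`, a polynomial in `x_1, …, x_N`. -/
def alternant (a b : ℝ) {N : ℕ} (ν : PosSign N) : MvPolynomial (Fin N) ℝ :=
  (Matrix.of fun i j : Fin N =>
    Polynomial.aeval (MvPolynomial.X j : MvPolynomial (Fin N) ℝ)
      (jacobiP a b (ν.shifted i))).det

theorem prime_X_sub_X {N : ℕ} {i j : Fin N} (hij : i ≠ j) :
    Prime (MvPolynomial.X i - MvPolynomial.X j : MvPolynomial (Fin N) ℝ) := by
  classical
  let f : MvPolynomial (Fin N) ℝ →ₐ[ℝ] MvPolynomial (Fin N) ℝ :=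
    MvPolynomial.aeval fun k => if k = i then MvPolynomial.X i + MvPolynomial.X j
      else MvPolynomial.X k
  let g : MvPolynomial (Fin N) ℝ →ₐ[ℝ] MvPolynomial (Fin N) ℝ :=
    MvPolynomial.aeval fun k => if k = i then MvPolynomial.X i - MvPolynomial.X j
      else MvPolynomial.X k
  have hfg : f.comp g = AlgHom.id ℝ _ := by
    ext1 k
    by_cases hk : k = i
    · subst hk; simp [f, g, hij.symm]
    · simp [f, g, hk]
  have hgf : g.comp f = AlgHom.id ℝ _ := by
    ext1 k
    by_cases hk : k = i
    · subst hk; simp [f, g, hij.symm]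
    · simp [f, g, hk]
  let e := AlgEquiv.ofAlgHom f g hfg hgf
  have h : e (MvPolynomial.X i - MvPolynomial.X j) = MvPolynomial.X i := by
    simp [e, f, hij.symm]
  rw [← MulEquiv.prime_iff e.toMulEquiv]
  change Prime (e _)
  rw [h]
  exact MvPolynomial.X_prime

theorem vandermondePoly_dvd_alternant (a b : ℝ) {N : ℕ} (ν : PosSign N) :
    vandermondePoly N ∣ alternant a b ν := by
  classical
  unfold vandermondePoly
  apply Finset.prod_dvd_of_isRelPrime
  · rintro ⟨i, j⟩ hp ⟨k, l⟩ hq hne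
    simp only [Finset.coe_filter, Finset.mem_univ, true_and, Set.mem_ofPred_eq] at hp hq
    change IsRelPrime (MvPolynomial.X i - MvPolynomial.X j : MvPolynomial (Fin N) ℝ)
      (MvPolynomial.X k - MvPolynomial.X l)
    rw [(prime_X_sub_X hp.ne).irreducible.isRelPrime_iff_not_dvd]
    rintro ⟨r, hr⟩
    -- a point with `x_i = x_j` and `x_k ≠ x_l`
    let v : Fin N → ℝ := fun m => if m = i ∨ m = j then 0 else (m : ℝ) + 1
    have h1 := congrArg (MvPolynomial.eval v) hr
    have hvi : v i = 0 := by simp [v]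
    have hvj : v j = 0 := by simp [v]
    simp only [map_sub, map_mul, MvPolynomial.eval_X, hvi, hvj, sub_self, zero_mul] at h1
    have hkl : (k : ℝ) ≠ (l : ℝ) := by
      have := hq.ne
      simpa [Fin.ext_iff] using this
    have hk0 : (0 : ℝ) ≤ (k : ℝ) := by positivity
    have hl0 : (0 : ℝ) ≤ (l : ℝ) := by positivity
    by_cases hk : k = i ∨ k = j <;> by_cases hl : l = i ∨ l = j
    · exfalso
      rcases hk with rfl | rfl <;> rcases hl with rfl | rfl
      · exact lt_irrefl _ hq
      · exact hne rfl
      · exact lt_asymm hp hq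
      · exact lt_irrefl _ hq
    · simp only [v, if_pos hk, if_neg hl] at h1; linarith
    · simp only [v, if_neg hk, if_pos hl] at h1; linarith
    · simp only [v, if_neg hk, if_neg hl] at h1; exact hkl (by linarith)
  · rintro ⟨i, j⟩ hp
    simp only [Finset.mem_filter, Finset.mem_univ, true_and] at hp
    -- subtract column `j` from column `i`
    have hd : alternant a b ν = ((Matrix.of fun r s : Fin N =>
        Polynomial.aeval (MvPolynomial.X s : MvPolynomial (Fin N) ℝ)
          (jacobiP a b (ν.shifted r))).updateCol i fun r =>
        Polynomial.aeval (MvPolynomial.X i : MvPolynomial (Fin N) ℝ)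
          (jacobiP a b (ν.shifted r)) -
        Polynomial.aeval (MvPolynomial.X j : MvPolynomial (Fin N) ℝ)
          (jacobiP a b (ν.shifted r))).det := by
      have := Matrix.det_updateCol_add_smul_self (Matrix.of fun r s : Fin N =>
        Polynomial.aeval (MvPolynomial.X s : MvPolynomial (Fin N) ℝ)
          (jacobiP a b (ν.shifted r))) hp.ne (-1)
      rw [alternant, ← this]
      congr 2
      ext1 r
      simp [sub_eq_add_neg]
    rw [hd, Matrix.det_apply]
    apply Finset.dvd_sum
    intro s _
    rw [Units.smul_def, zsmul_eq_mul]
    apply Dvd.dvd.mul_left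
    refine Dvd.dvd.trans ?_ (Finset.dvd_prod_of_mem _ (Finset.mem_univ i))
    simp only [Matrix.updateCol_self, Polynomial.aeval_def, Polynomial.eval₂_eq_eval_map]
    exact Polynomial.sub_dvd_eval_sub _ _ _

/-- The `N`-variate Jacobi polynomial `P_{ν,N}^{(a,b)} = det [P_{n_i}(x_j)] / V(x)`: the quotient
of an exact division of polynomials (see `vandermondePoly_mul_multiJacobi`). -/
def multiJacobi (a b : ℝ) {N : ℕ} (ν : PosSign N) : MvPolynomial (Fin N) ℝ :=
  (vandermondePoly_dvd_alternant a b ν).choose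

theorem vandermondePoly_mul_multiJacobi (a b : ℝ) {N : ℕ} (ν : PosSign N) :
    vandermondePoly N * multiJacobi a b ν = alternant a b ν :=
  (vandermondePoly_dvd_alternant a b ν).choose_spec.symm

/-- The normalized polynomial `P_{ν,N} / P_{ν,N}(1, …, 1)`. -/
def normJacobi (a b : ℝ) {N : ℕ} (ν : PosSign N) : MvPolynomial (Fin N) ℝ :=
  MvPolynomial.C (MvPolynomial.eval (fun _ => 1) (multiJacobi a b ν))⁻¹ * multiJacobi a b ν

/-! ### The matrix `Λ^N_K` -/

/-- The substitution `p ↦ p(x_1, …, x_K, 1, …, 1)`. -/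
def restrictVars {N : ℕ} (K : ℕ) (p : MvPolynomial (Fin N) ℝ) : MvPolynomial (Fin K) ℝ :=
  MvPolynomial.aeval
    (fun i : Fin N => if h : (i : ℕ) < K then MvPolynomial.X (⟨i, h⟩ : Fin K) else 1) p

/-- `c` is the system of coefficients in the finite expansion
`P̃_{ν,N}(x_1, …, x_K, 1, …, 1) = ∑_κ c(κ) P̃_{κ,K}(x_1, …, x_K)`. -/
def IsExpansion (a b : ℝ) {N K : ℕ} (ν : PosSign N) (c : PosSign K →₀ ℝ) : Prop :=
  restrictVars K (normJacobi a b ν) = c.sum fun κ r => MvPolynomial.C r * normJacobi a b κ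

open Classical in
/-- The row `Λ^N_K(ν, ·)`: the coefficients of the expansion above. -/
def Lam (a b : ℝ) {N : ℕ} (K : ℕ) (ν : PosSign N) : PosSign K →₀ ℝ :=
  if h : ∃ c : PosSign K →₀ ℝ, IsExpansion a b ν c then h.choose else 0

/-- `ε = (a + b + 1) / 2`. -/
def eps (a b : ℝ) : ℝ := (a + b + 1) / 2

/-- `d_K(κ; ε) = ∏_{i<j} ((k_i + ε)² - (k_j + ε)²) / ((K - i + ε)² - (K - j + ε)²)`,
where `k_i = κ_i + K - i`. -/
def dFactor (ε : ℝ) {K : ℕ} (κ : PosSign K) : ℝ :=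
  ∏ p : Fin K × Fin K with p.1 < p.2,
    (((κ.shifted p.1 : ℝ) + ε) ^ 2 - ((κ.shifted p.2 : ℝ) + ε) ^ 2) /
      ((((p.1.rev : ℕ) : ℝ) + ε) ^ 2 - (((p.2.rev : ℕ) : ℝ) + ε) ^ 2)

/-! ### Rational functions of `t` -/

/-- A real constant as a rational function. -/
def const (r : ℝ) : RatFunc ℂ := RatFunc.C (r : ℂ)

/-- The characteristic function
`F_N(t; ν; ε) = ∏_i (t² - (N - i + ε)²) / (t² - (ν_i + N - i + ε)²)`. -/
def charFun (ε : ℝ) {N : ℕ} (ν : PosSign N) : RatFunc ℂ :=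
  ∏ i : Fin N, (RatFunc.X ^ 2 - const ((((i.rev : ℕ) : ℝ) + ε) ^ 2)) /
    (RatFunc.X ^ 2 - const (((ν.shifted i : ℝ) + ε) ^ 2))

/-- The Pochhammer symbol `(x)_m = x (x + 1) ⋯ (x + m - 1)`. -/
def poch {F : Type*} [Field F] (x : F) (m : ℕ) : F := (ascPochhammer F m).eval x

/-- The sum of the terms `m = 0, …, k` of the hypergeometric series
`₄F₃[α₁, α₂, α₃, α₄; β₁, β₂, β₃ | 1]`; this is the whole series when `α₁ = -k`. -/
def hyp43 {F : Type*} [Field F] (k : ℕ) (α₁ α₂ α₃ α₄ β₁ β₂ β₃ : F) : F :=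
  ∑ m ∈ Finset.range (k + 1),
    poch α₁ m * poch α₂ m * poch α₃ m * poch α₄ m /
      (poch β₁ m * poch β₂ m * poch β₃ m * (m.factorial : F))

/-- `g_k(t; a, ε, L) = ₄F₃[-k, k + 2ε, L, L + a; -t + L + ε, t + L + ε, a + 1 | 1]`. -/
def gFun (a ε : ℝ) (L k : ℕ) : RatFunc ℂ :=
  hyp43 k (const (-k)) (const (k + 2 * ε)) (const L) (const (L + a))
    (-RatFunc.X + const (L + ε)) (RatFunc.X + const (L + ε)) (const (a + 1))

/-- `f` is regular at the point `z ∈ ℂ` (`f.denom` is the denominator in lowest terms). -/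
def RegularAt (f : RatFunc ℂ) (z : ℂ) : Prop := f.denom.eval z ≠ 0

/-- `f(-t) = f(t)`. -/
def IsEven (f : RatFunc ℂ) : Prop := f.eval RatFunc.C (-RatFunc.X) = f

/-- The set `(-𝔸(ε,L)) ∪ 𝔸(ε,L)`, where `𝔸(ε,L) = {L + ε, L + ε + 1, L + ε + 2, …}`. -/
def grid (ε : ℝ) (L : ℕ) : Set ℂ :=
  {z | ∃ m : ℕ, z = ((L + ε + m : ℝ) : ℂ) ∨ z = -((L + ε + m : ℝ) : ℂ)}

theorem RegularAt.add {f g : RatFunc ℂ} {z : ℂ} (hf : RegularAt f z) (hg : RegularAt g z) :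
    RegularAt (f + g) z := fun h =>
  mul_ne_zero hf hg (by
    rw [← Polynomial.eval_mul]
    exact Polynomial.eval_eq_zero_of_dvd_of_eval_eq_zero (RatFunc.denom_add_dvd f g) h)

theorem RegularAt.mul {f g : RatFunc ℂ} {z : ℂ} (hf : RegularAt f z) (hg : RegularAt g z) :
    RegularAt (f * g) z := fun h =>
  mul_ne_zero hf hg (by
    rw [← Polynomial.eval_mul]
    exact Polynomial.eval_eq_zero_of_dvd_of_eval_eq_zero (RatFunc.denom_mul_dvd f g) h)

theorem RegularAt.const (c z : ℂ) : RegularAt (RatFunc.C c) z := by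
  simp [RegularAt]

theorem eval_neg_denom_ne_zero (f : RatFunc ℂ) :
    Polynomial.eval₂ RatFunc.C (-RatFunc.X : RatFunc ℂ) f.denom ≠ 0 := by
  have h : Polynomial.eval₂ RatFunc.C (-RatFunc.X : RatFunc ℂ) f.denom =
      algebraMap (Polynomial ℂ) (RatFunc ℂ) (f.denom.comp (-Polynomial.X)) := by
    rw [Polynomial.comp, Polynomial.hom_eval₂]
    congr 1
    simp
  rw [h]
  intro h0
  rw [FaithfulSMul.algebraMap_eq_zero_iff, Polynomial.comp_neg_X_eq_zero_iff] at h0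
  exact f.denom_ne_zero h0

/-- The space `𝓕(ε, L)` of even rational functions, regular at infinity, whose only singularities
are simple poles in `(-𝔸(ε,L)) ∪ 𝔸(ε,L)`. A pole of `f` at `z` is at most simple exactly when
`(t - z) f(t)` is regular at `z`; regularity at infinity is `deg num ≤ deg denom`. -/
def evenSpace (ε : ℝ) (L : ℕ) : Submodule ℂ (RatFunc ℂ) where
  carrier := {f | IsEven f ∧ f.intDegree ≤ 0 ∧ (∀ z, z ∉ grid ε L → RegularAt f z) ∧
    ∀ z ∈ grid ε L, RegularAt ((RatFunc.X - RatFunc.C z) * f) z}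
  zero_mem' := by
    refine ⟨by simp [IsEven], by simp, fun z _ => by simp [RegularAt], fun z _ => ?_⟩
    simp [RegularAt]
  add_mem' := by
    rintro f g ⟨h1, h2, h3, h4⟩ ⟨k1, k2, k3, k4⟩
    refine ⟨?_, ?_, fun z hz => (h3 z hz).add (k3 z hz), fun z hz => ?_⟩
    · unfold IsEven at *
      rw [RatFunc.eval_add _ _ (eval_neg_denom_ne_zero f) (eval_neg_denom_ne_zero g), h1, k1]
    · by_cases hg : g = 0
      · simpa [hg] using h2
      by_cases hfg : f + g = 0
      · simp [hfg]
      exact (RatFunc.intDegree_add_le hg hfg).trans (max_le h2 k2)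
    · rw [mul_add]
      exact (h4 z hz).add (k4 z hz)
  smul_mem' := by
    rintro c f ⟨h1, h2, h3, h4⟩
    have hc : c • f = RatFunc.C c * f := RatFunc.smul_eq_C_mul c f
    rw [hc]
    refine ⟨?_, ?_, fun z hz => (RegularAt.const c z).mul (h3 z hz), fun z hz => ?_⟩
    · unfold IsEven at *
      rw [RatFunc.eval_mul _ _ (eval_neg_denom_ne_zero _) (eval_neg_denom_ne_zero f), h1,
        RatFunc.eval_C]
    · by_cases hc0 : c = 0
      · simp [hc0]
      by_cases hf : f = 0
      · simp [hf]
      rw [RatFunc.intDegree_mul (by simpa using hc0) hf]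
      simpa using h2
    · rw [mul_left_comm]
      exact (RegularAt.const c z).mul (h4 z hz)

end JacobiBranching

end

noncomputable section

namespace JacobiBranching

open Finset

/-! ### Signatures and strictly decreasing sequences -/

/-! Write `z_j = (j + ε)²`, `c_m = 1 / ((a+1)_m m! 2^m)`, `n_i = ν_i + N - i`, `d = N - K`, so that
`L = d + 1`. Up to a constant, the Jacobi polynomial of degree `n` is `Q_n = ∑_m c_m (z_n -
z_0)⋯(z_n - z_{m-1}) (x - 1)^m` (`jacobiP_eq`): a Newton expansion in the spectral variable `z_n`,
centred at the point `x = 1` where variables are frozen.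

Let `w_i` be the barycentric weights of the nodes `z_{n_i}` and `φ_q = ∏_{q<j<N} (u - z_j)`. The
functional `f ↦ ∑_i w_i f(z_{n_i})` is a divided difference, so it kills degrees below `N - 1`;
hence `∑_i w_i φ_q(z_{n_i}) Q_{n_i} = (x - 1)^q h_q` with `h_q(1) = c_q`. Row operations thus turn
`det [Q_{n_i}(x_j)]` into a multiple of `det [(x_j - 1)^{N-i} h_{N-i}(x_j)]`. In this flag form each
substitution `x = 1` removes one row and column and lowers the other powers by one, so the
restricted polynomial times the Vandermonde product is a multiple of `det [(x_j - 1)^{K-i}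
h_{K-i+d}(x_j)]` (`vandermondePoly_mul_restrictHom`).

The linear isomorphism `evenEquiv` from `ℂ[x]` to `𝓕(ε, L)` sends `Q_k` to `g_k`
(`gFun_eq_realTrans`), which makes the `g_k` a basis. It sends `(x - 1)^k h_{k+d}` to `c_d F_N /
∏_{j<k} (t² - z_{L+j})` (`realTrans_pow_mul_flagPoly`), by the Newton expansion of the kernel `1 /
(u - s)` and Lagrange interpolation of `φ_{k+d}`. Therefore `g_k F_N`, for `k < K`, comes from
`mulPoly`, a triangular combination of the flag polynomials.

So the restricted determinant is a constant times the determinant of the `mulPoly`s. Expanding these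
in the `Q_m` and applying Cauchy–Binet (`det_sum_mul_eq`) gives the expansion over `κ`, with the
determinants of the coefficients of `g_{K-j} F_N`; comparing normalizations leaves the ratio of
Vandermonde products `d_K(κ; ε)`. Uniqueness is `linearIndependent_normJacobi`. -/

theorem PosSign.shifted_strictAnti {N : ℕ} (ν : PosSign N) : StrictAnti ν.shifted := by
  intro i j hij
  have h1 := ν.2 hij.le
  have h2 : (j.rev : ℕ) < i.rev := Fin.rev_lt_rev.2 hij
  simp only [PosSign.shifted]
  omega

theorem PosSign.shifted_injective (N : ℕ) :
    Function.Injective (PosSign.shifted : PosSign N → Fin N → ℕ) := by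
  intro ν μ h
  ext i
  have := congrFun h i
  simpa [PosSign.shifted] using this

theorem StrictAnti.rev_add_le {N : ℕ} {f : Fin N → ℕ} (hf : StrictAnti f) (i j : Fin N)
    (hij : i ≤ j) : f j + (i.rev : ℕ) ≤ f i + (j.rev : ℕ) := by
  obtain ⟨d, hd⟩ : ∃ d, (j : ℕ) = i + d := ⟨j - i, by have : (i : ℕ) ≤ j := hij; omega⟩
  induction d generalizing j with
  | zero =>
    have : i = j := Fin.ext (by omega)
    subst this; rfl
  | succ d ih =>
    have hj := j.isLt
    have h1 := ih ⟨i + d, by omega⟩ (by simp [Fin.le_def]) rfl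
    have h2 : f j < f ⟨i + d, by omega⟩ := hf (by simp [Fin.lt_def, hd])
    simp only [Fin.val_rev] at *
    omega

theorem PosSign.exists_shifted_eq {N : ℕ} {f : Fin N → ℕ} (hf : StrictAnti f) :
    ∃ ν : PosSign N, ν.shifted = f := by
  have key : ∀ i : Fin N, (i.rev : ℕ) ≤ f i := by
    intro i
    have hi := i.isLt
    have := StrictAnti.rev_add_le hf i ⟨N - 1, by omega⟩ (by simp [Fin.le_def]; omega)
    simp only [Fin.val_rev] at *
    omega
  refine ⟨⟨fun i => f i - (i.rev : ℕ), fun i j hij => ?_⟩, ?_⟩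
  · have h1 := StrictAnti.rev_add_le hf i j hij
    have h2 := key i
    have h3 := key j
    change f j - _ ≤ f i - _
    omega
  · funext i
    have := key i
    simp only [PosSign.shifted]
    omega

/-- A strictly monotone sequence is determined by its range, and permutations do not change the
range. -/
theorem PosSign.eq_of_shifted_comp_perm {K : ℕ} {κ μ : PosSign K} {σ τ : Equiv.Perm (Fin K)}
    (h : κ.shifted ∘ σ = μ.shifted ∘ τ) : κ = μ := by
  have hr : Set.range κ.shifted = Set.range μ.shifted := by
    rw [← σ.surjective.range_comp κ.shifted, h, τ.surjective.range_comp]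
  have h1 : κ.shifted = μ.shifted := by
    have h2 : StrictMono (κ.shifted ∘ Fin.rev) := fun i j hij =>
      κ.shifted_strictAnti (Fin.rev_lt_rev.2 hij)
    have h3 : StrictMono (μ.shifted ∘ Fin.rev) := fun i j hij =>
      μ.shifted_strictAnti (Fin.rev_lt_rev.2 hij)
    have h4 : κ.shifted ∘ Fin.rev = μ.shifted ∘ Fin.rev := by
      rw [← StrictMono.range_inj h2 h3, Fin.rev_surjective.range_comp,
        Fin.rev_surjective.range_comp, hr]
    funext i
    simpa using congrFun h4 i.rev
  exact PosSign.shifted_injective K h1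

/-- The signatures with all shifted coordinates below `n`. -/
def boundedSign (K n : ℕ) : Finset (PosSign K) :=
  (Fintype.piFinset fun _ : Fin K => range n).preimage PosSign.shifted
    (PosSign.shifted_injective K).injOn

theorem mem_boundedSign {K n : ℕ} {κ : PosSign K} :
    κ ∈ boundedSign K n ↔ ∀ i, κ.shifted i < n := by
  simp [boundedSign]

/-- Sorting an injective tuple writes it uniquely as a strictly decreasing one, that is, some
`κ.shifted`, followed by a permutation. -/
theorem sum_injective_eq_sum_boundedSign {R : Type*} [AddCommMonoid R] (K n : ℕ)
    (Φ : (Fin K → ℕ) → R) (h0 : ∀ f, ¬ Function.Injective f → Φ f = 0) :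
    ∑ f ∈ Fintype.piFinset fun _ : Fin K => range n, Φ f =
      ∑ κ ∈ boundedSign K n, ∑ σ : Equiv.Perm (Fin K), Φ (κ.shifted ∘ σ) := by
  classical
  rw [← sum_product', ← sum_filter_of_ne (p := Function.Injective)
    (fun f _ hf => by by_contra h; exact hf (h0 f h))]
  symm
  refine sum_bij (fun x _ => x.1.shifted ∘ x.2) ?_ ?_ ?_ fun _ _ => rfl
  · rintro ⟨κ, σ⟩ hx
    simp only [mem_product, mem_boundedSign, mem_univ, and_true] at hx
    simp only [mem_filter, Fintype.mem_piFinset, Function.comp_apply, mem_range]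
    exact ⟨fun i => hx _, κ.shifted_strictAnti.injective.comp σ.injective⟩
  · rintro ⟨κ, σ⟩ _ ⟨μ, τ⟩ _ h
    dsimp only at h
    have h5 := PosSign.eq_of_shifted_comp_perm h
    subst h5
    have : σ = τ := by
      ext1 i
      exact κ.shifted_strictAnti.injective (congrFun h i)
    rw [this]
  · intro f hf
    simp only [mem_filter, Fintype.mem_piFinset, mem_range] at hf
    obtain ⟨hf1, hf2⟩ := hf
    have hs : StrictMono (f ∘ Tuple.sort f) :=
      (Tuple.monotone_sort f).strictMono_of_injective (hf2.comp (Tuple.sort f).injective)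
    have ha : StrictAnti (f ∘ Tuple.sort f ∘ Fin.rev) := fun i j hij => hs (Fin.rev_lt_rev.2 hij)
    obtain ⟨κ, hκ⟩ := PosSign.exists_shifted_eq ha
    refine ⟨⟨κ, (Tuple.sort f).symm.trans Fin.revPerm⟩, ?_, ?_⟩
    · simp only [mem_product, mem_boundedSign, mem_univ, and_true]
      intro i
      rw [hκ]
      exact hf1 _
    · funext i
      simp [hκ]

/-- The Cauchy–Binet formula for a product of a `K × n` and an `n × K` matrix. -/
theorem det_sum_mul_eq {R : Type*} [CommRing R] (K n : ℕ) (ρ : Fin K → ℕ → R)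
    (q : ℕ → Fin K → R) :
    (Matrix.of fun j l : Fin K => ∑ m ∈ range n, ρ j m * q m l).det =
      ∑ κ ∈ boundedSign K n, (Matrix.of fun i j : Fin K => ρ j (κ.shifted i)).det *
        (Matrix.of fun i l : Fin K => q (κ.shifted i) l).det := by
  classical
  let Φ : (Fin K → ℕ) → R := fun f => (∏ j, ρ j (f j)) * (Matrix.of fun j l => q (f j) l).det
  have h1 : (Matrix.of fun j l : Fin K => ∑ m ∈ range n, ρ j m * q m l).det =
      ∑ f ∈ Fintype.piFinset fun _ : Fin K => range n, Φ f := by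
    have : (Matrix.of fun j l : Fin K => ∑ m ∈ range n, ρ j m * q m l) =
        fun j => ∑ m ∈ range n, ρ j m • q m := by
      ext j l
      simp [Finset.sum_apply]
    rw [this]
    have h2 := (Matrix.detRowAlternating (n := Fin K) (R := R)).toMultilinearMap.map_sum_finset
      (fun j m => ρ j m • q m) (fun _ => range n)
    refine h2.trans (sum_congr rfl fun f _ => ?_)
    exact (Matrix.detRowAlternating (n := Fin K) (R := R)).toMultilinearMap.map_smul_univ
      (fun j => ρ j (f j)) (fun j => q (f j))
  rw [h1, sum_injective_eq_sum_boundedSign]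
  · refine sum_congr rfl fun κ _ => ?_
    rw [Matrix.det_apply', sum_mul]
    refine sum_congr rfl fun σ _ => ?_
    have h3 : (Matrix.of fun j l : Fin K => q (κ.shifted (σ j)) l).det =
        (Equiv.Perm.sign σ : R) * (Matrix.of fun i l : Fin K => q (κ.shifted i) l).det := by
      rw [← Matrix.det_permute]
      rfl
    simp only [Φ, Function.comp_apply, h3, Matrix.of_apply]
    ring
  · intro f hf
    obtain ⟨i, j, hij, hne⟩ : ∃ i j, f i = f j ∧ i ≠ j := by
      simpa [Function.Injective] using hf
    simp only [Φ]
    rw [Matrix.det_zero_of_row_eq hne (by ext l; simp [hij]), mul_zero]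

/-! ### Vandermonde determinants in decreasing order -/

theorem prod_rev_pairs {R : Type*} [CommMonoid R] {N : ℕ} (F : Fin N → Fin N → R) :
    ∏ i : Fin N, ∏ j ∈ Ioi i, F j.rev i.rev =
      ∏ p : Fin N × Fin N with p.1 < p.2, F p.1 p.2 := by
  rw [prod_sigma']
  refine prod_nbij' (fun x => (x.2.rev, x.1.rev)) (fun p => ⟨p.2.rev, p.1.rev⟩) ?_ ?_ ?_ ?_ ?_
  all_goals simp

theorem det_eval_monic_rev {R : Type*} [CommRing R] {N : ℕ} (v : Fin N → R)
    (p : ℕ → Polynomial R) (hdeg : ∀ m, (p m).natDegree = m) (hmonic : ∀ m, (p m).Monic) :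
    (Matrix.of fun i j : Fin N => (p (j.rev : ℕ)).eval (v i)).det =
      ∏ p : Fin N × Fin N with p.1 < p.2, (v p.1 - v p.2) := by
  have h := Matrix.det_eval_matrixOfPolynomials_eq_det_vandermonde (v ∘ Fin.rev)
    (fun j => p (j : ℕ)) (fun j => hdeg j) (fun j => hmonic j)
  rw [Matrix.det_vandermonde] at h
  rw [← prod_rev_pairs fun i j => v i - v j]
  simp only [Function.comp_apply] at h
  rw [h, ← Matrix.det_submatrix_equiv_self Fin.revPerm]
  congr 1
  ext i j
  simp only [Matrix.submatrix_apply, Matrix.of_apply, Fin.revPerm_apply, Fin.rev_rev]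

theorem vandermondePoly_ne_zero (N : ℕ) : vandermondePoly N ≠ 0 := by
  rw [vandermondePoly, prod_ne_zero_iff]
  rintro ⟨i, j⟩ h
  simp only [mem_filter, mem_univ, true_and] at h
  exact (prime_X_sub_X h.ne).ne_zero

/-! ### Setting variables equal to one -/

/-- `restrictVars` as a homomorphism of algebras. -/
def restrictHom (N K : ℕ) : MvPolynomial (Fin N) ℝ →ₐ[ℝ] MvPolynomial (Fin K) ℝ :=
  MvPolynomial.aeval
    fun i : Fin N => if h : (i : ℕ) < K then MvPolynomial.X (⟨i, h⟩ : Fin K) else 1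

theorem restrictHom_apply {N K : ℕ} (p : MvPolynomial (Fin N) ℝ) :
    restrictHom N K p = restrictVars K p := rfl

theorem restrictHom_restrictHom {N M K : ℕ} (h : K ≤ M) (p : MvPolynomial (Fin N) ℝ) :
    restrictHom M K (restrictHom N M p) = restrictHom N K p := by
  rw [← AlgHom.comp_apply]
  congr 1
  ext1 i
  by_cases h1 : (i : ℕ) < M
  · simp [restrictHom, h1]
  · have : ¬ (i : ℕ) < K := by omega
    simp [restrictHom, h1, this]

theorem restrictHom_self {N : ℕ} (p : MvPolynomial (Fin N) ℝ) : restrictHom N N p = p := by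
  have : restrictHom N N = AlgHom.id ℝ _ := by
    ext1 i
    simp [restrictHom]
  rw [this]; rfl

theorem restrictHom_X_castSucc {n : ℕ} (i : Fin n) :
    restrictHom (n + 1) n (MvPolynomial.X i.castSucc) = MvPolynomial.X i := by
  simp [restrictHom]

theorem restrictHom_X_last {n : ℕ} :
    restrictHom (n + 1) n (MvPolynomial.X (Fin.last n)) = 1 := by
  simp [restrictHom]

theorem restrictHom_vandermondePoly (n : ℕ) :
    restrictHom (n + 1) n (vandermondePoly (n + 1)) =
      vandermondePoly n * ∏ j : Fin n, (MvPolynomial.X j - 1) := by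
  have h : ∀ m, vandermondePoly m =
      ∏ j : Fin m, ∏ i ∈ Iio j, (MvPolynomial.X i - MvPolynomial.X j) := by
    intro m
    rw [vandermondePoly, prod_sigma']
    refine prod_nbij' (fun p => ⟨p.2, p.1⟩) (fun x => (x.2, x.1)) ?_ ?_ ?_ ?_ ?_
    all_goals simp
  rw [h, h, map_prod, Fin.prod_univ_castSucc]
  congr 1
  · refine prod_congr rfl fun j _ => ?_
    rw [map_prod, ← Fin.map_castSuccEmb_Iio, prod_map]
    refine prod_congr rfl fun i _ => ?_
    simp [restrictHom_X_castSucc]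
  · rw [map_prod, Fin.Iio_last_eq_map, prod_map]
    refine prod_congr rfl fun i _ => ?_
    simp [restrictHom_X_castSucc, restrictHom_X_last]

/-! ### Flag determinants and their restriction. -/

/-- The matrix `[(X_j - 1)^(N-i) h_(N-i)(X_j)]`. -/
def flagMatrix (N : ℕ) (h : ℕ → Polynomial ℝ) :
    Matrix (Fin N) (Fin N) (MvPolynomial (Fin N) ℝ) :=
  Matrix.of fun i j => Polynomial.aeval (MvPolynomial.X j : MvPolynomial (Fin N) ℝ)
    ((Polynomial.X - 1) ^ (i.rev : ℕ) * h i.rev)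

/-- At `x_{n+1} = 1` every entry of the last column vanishes except the bottom one, whose exponent
is `0`. In the remaining minor all exponents are positive, so each column releases a factor `x_j -
1`. -/
theorem restrictHom_det_flagMatrix (n : ℕ) (h : ℕ → Polynomial ℝ) :
    restrictHom (n + 1) n (flagMatrix (n + 1) h).det =
      MvPolynomial.C ((h 0).eval 1) * (flagMatrix n fun q => h (q + 1)).det *
        ∏ j : Fin n, (MvPolynomial.X j - 1) := by
  rw [AlgHom.map_det, Matrix.det_succ_column _ (Fin.last n), Fin.sum_univ_castSucc]
  have hz : ∀ i : Fin n, (restrictHom (n + 1) n).mapMatrix (flagMatrix (n + 1) h) i.castSucc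
      (Fin.last n) = 0 := by
    intro i
    have : n - (i : ℕ) ≠ 0 := by have := i.isLt; omega
    simp [flagMatrix, ← Polynomial.aeval_algHom_apply, restrictHom_X_last, this, Fin.val_rev]
  rw [sum_eq_zero (fun i _ => by rw [hz]; ring), zero_add]
  have hl : (restrictHom (n + 1) n).mapMatrix (flagMatrix (n + 1) h) (Fin.last n) (Fin.last n) =
      MvPolynomial.C ((h 0).eval 1) := by
    simp only [flagMatrix, AlgHom.mapMatrix_apply, Matrix.map_apply, Matrix.of_apply,
      ← Polynomial.aeval_algHom_apply, restrictHom_X_last, Fin.rev_last, Fin.val_zero, pow_zero,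
      one_mul]
    rw [← map_one (algebraMap ℝ (MvPolynomial (Fin n) ℝ)),
      Polynomial.aeval_algebraMap_apply, Polynomial.coe_aeval_eq_eval]
    rfl
  rw [hl]
  have hd : (((restrictHom (n + 1) n).mapMatrix (flagMatrix (n + 1) h)).submatrix
      (Fin.last n).succAbove (Fin.last n).succAbove) =
      Matrix.of fun i j => (MvPolynomial.X j - 1) * flagMatrix n (fun q => h (q + 1)) i j := by
    ext1 i j
    simp only [Matrix.submatrix_apply, Fin.succAbove_last, flagMatrix, AlgHom.mapMatrix_apply,
      Matrix.map_apply, Matrix.of_apply, ← Polynomial.aeval_algHom_apply, restrictHom_X_castSucc,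
      Fin.rev_castSucc, Fin.val_succ]
    simp only [map_mul, map_pow, map_sub, Polynomial.aeval_X, map_one]
    ring
  rw [hd, Matrix.det_mul_row]
  simp only [Fin.val_last, ← two_mul, pow_mul]
  ring

/-- Induction on the number of frozen variables: the factors `x_j - 1` on the two sides cancel,
leaving the same kind of identity with `h` shifted by one. -/
theorem vandermondePoly_mul_restrictHom {K : ℕ} (d : ℕ) (h : ℕ → Polynomial ℝ)
    (A : MvPolynomial (Fin (K + d)) ℝ)
    (hA : vandermondePoly (K + d) * A = (flagMatrix (K + d) h).det) :
    vandermondePoly K * restrictHom (K + d) K A =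
      MvPolynomial.C (∏ q ∈ range d, (h q).eval 1) * (flagMatrix K fun q => h (q + d)).det := by
  induction d generalizing h with
  | zero => simpa [restrictHom_self] using hA
  | succ d ih =>
    change MvPolynomial (Fin (K + d + 1)) ℝ at A
    change vandermondePoly (K + d + 1) * A = (flagMatrix (K + d + 1) h).det at hA
    have hA1 := congrArg (restrictHom (K + d + 1) (K + d)) hA
    rw [map_mul, restrictHom_vandermondePoly, restrictHom_det_flagMatrix] at hA1
    have hne : (∏ j : Fin (K + d), (MvPolynomial.X j - 1 : MvPolynomial (Fin (K + d)) ℝ)) ≠ 0 := by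
      rw [prod_ne_zero_iff]
      intro j _ hj
      have := congrArg (MvPolynomial.eval fun _ => (0 : ℝ)) hj
      simp at this
    have hA2 : vandermondePoly (K + d) * restrictHom (K + d + 1) (K + d) A =
        MvPolynomial.C ((h 0).eval 1) * (flagMatrix (K + d) fun q => h (q + 1)).det := by
      apply mul_right_cancel₀ hne
      linear_combination hA1
    -- The induction hypothesis needs a relation without a constant factor, obtained by dividing by
    -- `h_0(1)`; if this is zero, both sides vanish.
    by_cases h0 : (h 0).eval 1 = 0
    · have hz : restrictHom (K + d + 1) (K + d) A = 0 := by
        rw [h0, map_zero, zero_mul] at hA2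
        exact (mul_eq_zero.1 hA2).resolve_left (vandermondePoly_ne_zero _)
      have : restrictHom (K + (d + 1)) K A = 0 := by
        rw [← restrictHom_restrictHom (M := K + d) (by omega)]
        exact (congrArg _ hz).trans (map_zero _)
      rw [this, prod_range_succ', h0]
      simp
    · have hi := ih (fun q => h (q + 1))
        (MvPolynomial.C ((h 0).eval 1)⁻¹ * restrictHom (K + d + 1) (K + d) A) (by
          rw [mul_left_comm, hA2, ← mul_assoc, ← map_mul, inv_mul_cancel₀ h0]; simp)
      rw [map_mul, restrictHom_restrictHom (by omega), ← MvPolynomial.algebraMap_eq,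
        AlgHom.commutes, MvPolynomial.algebraMap_eq] at hi
      have hc : (MvPolynomial.C ((h 0).eval 1) * MvPolynomial.C ((h 0).eval 1)⁻¹ :
          MvPolynomial (Fin K) ℝ) = 1 := by
        rw [← map_mul, mul_inv_cancel₀ h0, map_one]
      have hi2 := congrArg (fun x => MvPolynomial.C ((h 0).eval 1) * x) hi
      rw [prod_range_succ', map_mul]
      simp only [add_assoc] at hi2 ⊢
      linear_combination hi2 - (vandermondePoly K * restrictHom (K + (d + 1)) K A) * hc

/-- Freezing all variables, the case `K = 0`, where the Vandermonde product and the determinant are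
empty. -/
theorem eval_one_eq_of_vandermondePoly_mul {N : ℕ} (h : ℕ → Polynomial ℝ)
    (A : MvPolynomial (Fin N) ℝ) (hA : vandermondePoly N * A = (flagMatrix N h).det) :
    MvPolynomial.eval (fun _ => 1) A = ∏ q ∈ range N, (h q).eval 1 := by
  have key : MvPolynomial.eval (fun _ => 1) A =
      MvPolynomial.eval (fun _ => 1) (restrictHom N 0 A) := by
    have : (MvPolynomial.aeval (fun _ => (1 : ℝ)) : MvPolynomial (Fin N) ℝ →ₐ[ℝ] ℝ) =
        (MvPolynomial.aeval (fun _ => (1 : ℝ)) : MvPolynomial (Fin 0) ℝ →ₐ[ℝ] ℝ).comp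
          (restrictHom N 0) := by
      ext1 i
      simp [restrictHom]
    have := DFunLike.congr_fun this A
    simpa [MvPolynomial.aeval_def, MvPolynomial.eval₂_id] using this
  rw [key]
  have : ∀ M (hM : M = 0 + N) (A : MvPolynomial (Fin M) ℝ),
      vandermondePoly M * A = (flagMatrix M h).det →
      restrictHom M 0 A = MvPolynomial.C (∏ q ∈ range N, (h q).eval 1) := by
    rintro M rfl A hA
    have := vandermondePoly_mul_restrictHom N h A hA
    simpa [vandermondePoly] using this
  rw [this N (by omega) A hA, MvPolynomial.eval_C]

/-! ### The space of even rational functions -/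

/-- The nodes `(j + ε)²`. -/
def node (ε : ℝ) (j : ℕ) : ℝ := ((j : ℝ) + ε) ^ 2

theorem node_strictMono {ε : ℝ} (hε : 0 ≤ ε) : StrictMono (node ε) := by
  intro i j hij
  have : (i : ℝ) < j := by exact_mod_cast hij
  unfold node
  have : (0 : ℝ) ≤ i := by positivity
  gcongr

/-- The elementary functions `1 / ∏_{j<m} (t² - (L + j + ε)²)`. -/
def elemFun (ε : ℝ) (L m : ℕ) : RatFunc ℂ :=
  ∏ j ∈ range m, (RatFunc.X ^ 2 - const (node ε (L + j)))⁻¹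

theorem X_sq_sub_const_eq (r : ℝ) : (RatFunc.X ^ 2 - const r : RatFunc ℂ) =
    algebraMap (Polynomial ℂ) (RatFunc ℂ) (Polynomial.X ^ 2 - Polynomial.C (r : ℂ)) := by
  simp [const, RatFunc.algebraMap_X, RatFunc.algebraMap_C]

theorem X_sq_sub_C_ne_zero (r : ℂ) : (Polynomial.X ^ 2 - Polynomial.C r : Polynomial ℂ) ≠ 0 :=
  Polynomial.X_pow_sub_C_ne_zero (by norm_num) r

theorem X_sq_sub_const_ne_zero (r : ℝ) : (RatFunc.X ^ 2 - const r : RatFunc ℂ) ≠ 0 := by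
  rw [X_sq_sub_const_eq]
  exact RatFunc.algebraMap_ne_zero (X_sq_sub_C_ne_zero _)

theorem regularAt_of_mul_eq {f : RatFunc ℂ} {z : ℂ} (p q : Polynomial ℂ)
    (h : f * algebraMap _ _ q = algebraMap _ _ p) (hq : q.eval z ≠ 0) : RegularAt f z := by
  have hq0 : q ≠ 0 := by rintro rfl; simp at hq
  intro h0
  have hd : f.denom ∣ q := by
    rw [RatFunc.denom_dvd hq0]
    exact ⟨p, by rw [eq_div_iff (RatFunc.algebraMap_ne_zero hq0), h]⟩
  exact hq (Polynomial.eval_eq_zero_of_dvd_of_eval_eq_zero hd h0)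

/-- The substitution `t ↦ -t`. -/
def negHom : RatFunc ℂ →+* RatFunc ℂ where
  toFun f := f.eval RatFunc.C (-RatFunc.X)
  map_one' := by simp
  map_zero' := by simp
  map_add' f g := RatFunc.eval_add _ _ (eval_neg_denom_ne_zero f) (eval_neg_denom_ne_zero g)
  map_mul' f g := RatFunc.eval_mul _ _ (eval_neg_denom_ne_zero f) (eval_neg_denom_ne_zero g)

theorem isEven_iff {f : RatFunc ℂ} : IsEven f ↔ negHom f = f := Iff.rfl

theorem negHom_X : negHom RatFunc.X = -RatFunc.X := by simp [negHom]

theorem negHom_C (c : ℂ) : negHom (RatFunc.C c) = RatFunc.C c := by simp [negHom]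

theorem negHom_algebraMap (p : Polynomial ℂ) : negHom (algebraMap _ _ p) =
    algebraMap _ _ (p.comp (-Polynomial.X)) := by
  induction p using Polynomial.induction_on' with
  | add p q hp hq => rw [map_add, map_add, hp, hq, Polynomial.add_comp, map_add]
  | monomial n c =>
    rw [← Polynomial.C_mul_X_pow_eq_monomial]
    simp [RatFunc.algebraMap_X, RatFunc.algebraMap_C, negHom_X, negHom_C]

theorem isEven_X_sq_sub_const (r : ℝ) : negHom (RatFunc.X ^ 2 - const r) =
    RatFunc.X ^ 2 - const r := by
  simp [const, negHom_X, negHom_C]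

theorem RegularAt.prod {ι : Type*} (s : Finset ι) (f : ι → RatFunc ℂ) {z : ℂ}
    (h : ∀ i ∈ s, RegularAt (f i) z) : RegularAt (∏ i ∈ s, f i) z := by
  classical
  induction s using Finset.induction_on with
  | empty => simp [RegularAt]
  | insert i s hi ih =>
    rw [prod_insert hi]
    exact (h i (by simp)).mul (ih fun j hj => h j (by simp [hj]))

theorem regularAt_inv_X_sq_sub {r : ℝ} {z : ℂ} (h : z ^ 2 ≠ r) :
    RegularAt (RatFunc.X ^ 2 - const r)⁻¹ z := by
  refine regularAt_of_mul_eq 1 (Polynomial.X ^ 2 - Polynomial.C (r : ℂ)) ?_ ?_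
  · rw [X_sq_sub_const_eq, inv_mul_cancel₀, map_one]
    exact RatFunc.algebraMap_ne_zero (X_sq_sub_C_ne_zero _)
  · simpa [sub_eq_zero] using h

theorem regularAt_X_sub_mul_inv {r : ℝ} {z : ℂ} (h : z ^ 2 = r) (hr : r ≠ 0) :
    RegularAt ((RatFunc.X - RatFunc.C z) * (RatFunc.X ^ 2 - const r)⁻¹) z := by
  have hz : z ≠ 0 := by
    rintro rfl
    exact hr (by exact_mod_cast (by simpa using h.symm : (r : ℂ) = 0))
  refine regularAt_of_mul_eq 1 (Polynomial.X + Polynomial.C z) ?_ ?_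
  · have : (RatFunc.X ^ 2 - const r : RatFunc ℂ) =
        (RatFunc.X - RatFunc.C z) * (RatFunc.X + RatFunc.C z) := by
      rw [const, ← h, map_pow]; ring
    have h0 := X_sq_sub_const_ne_zero r
    rw [mul_right_comm, map_add, RatFunc.algebraMap_X, RatFunc.algebraMap_C, ← this,
      mul_inv_cancel₀ h0, map_one]
  · simpa using hz

theorem mem_grid_iff {ε : ℝ} {L : ℕ} {z : ℂ} :
    z ∈ grid ε L ↔ ∃ m : ℕ, z ^ 2 = (node ε (L + m) : ℝ) := by
  simp only [grid, Set.mem_ofPred_eq]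
  refine exists_congr fun m => ?_
  have : ((node ε (L + m) : ℝ) : ℂ) = ((L + ε + m : ℝ) : ℂ) ^ 2 := by
    simp only [node]; push_cast; ring
  rw [this, sq_eq_sq_iff_eq_or_eq_neg]

theorem node_pos {ε : ℝ} (hε : 0 ≤ ε) {j : ℕ} (hj : 1 ≤ j) : 0 < node ε j := by
  have : (1 : ℝ) ≤ j := by exact_mod_cast hj
  unfold node
  positivity

/-- The nodes are distinct, so a grid point is a zero of at most one factor `t² - z_{L+j}`. As `L ≥
1`, the node is nonzero and the two roots `±(L + j + ε)` differ, which makes the pole simple. -/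
theorem elemFun_mem {ε : ℝ} (hε : 0 ≤ ε) {L : ℕ} (hL : 1 ≤ L) (m : ℕ) :
    elemFun ε L m ∈ evenSpace ε L := by
  refine ⟨?_, ?_, ?_, ?_⟩
  · rw [isEven_iff, elemFun, map_prod]
    exact prod_congr rfl fun j _ => by rw [map_inv₀, isEven_X_sq_sub_const]
  · induction m with
    | zero => simp [elemFun]
    | succ m ih =>
      rw [elemFun, prod_range_succ, RatFunc.intDegree_mul
        (prod_ne_zero_iff.2 fun j _ => inv_ne_zero (X_sq_sub_const_ne_zero _))
        (inv_ne_zero (X_sq_sub_const_ne_zero _)), RatFunc.intDegree_inv, X_sq_sub_const_eq,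
        RatFunc.intDegree_polynomial]
      have : (0 : ℤ) ≤ ((Polynomial.X ^ 2 - Polynomial.C ((node ε (L + m) : ℝ) : ℂ) :
        Polynomial ℂ).natDegree : ℤ) := by positivity
      have h2 := ih
      rw [elemFun] at h2
      linarith
  · intro z hz
    refine RegularAt.prod _ _ fun j _ => regularAt_inv_X_sq_sub fun h => hz ?_
    exact mem_grid_iff.2 ⟨j, h⟩
  · intro z hz
    obtain ⟨i, hi⟩ := mem_grid_iff.1 hz
    have hreg : ∀ j, j ≠ i → RegularAt (RatFunc.X ^ 2 - const (node ε (L + j)))⁻¹ z := by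
      intro j hj
      apply regularAt_inv_X_sq_sub
      rw [hi]
      intro h
      have h2 : node ε (L + i) = node ε (L + j) := by exact_mod_cast h
      have := (node_strictMono hε).injective h2
      omega
    by_cases him : i ∈ range m
    · rw [elemFun, ← mul_prod_erase _ _ him, ← mul_assoc]
      refine (regularAt_X_sub_mul_inv hi (node_pos hε (by omega)).ne').mul ?_
      exact RegularAt.prod _ _ fun j hj => hreg j (ne_of_mem_erase hj)
    · refine RegularAt.mul ?_ (RegularAt.prod _ _ fun j hj => hreg j ?_)
      · refine regularAt_of_mul_eq (Polynomial.X - Polynomial.C z) 1 ?_ (by simp)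
        simp [RatFunc.algebraMap_X, RatFunc.algebraMap_C]
      · rintro rfl; exact him hj

/-! ### The elementary functions span the even space and are independent. -/

/-- The image of a polynomial in `u` under `u = t²`. -/
def sqHom : Polynomial ℂ →ₐ[ℂ] RatFunc ℂ := Polynomial.aeval (RatFunc.X ^ 2)

theorem sqHom_X : sqHom Polynomial.X = RatFunc.X ^ 2 := by simp [sqHom]

theorem sqHom_C (r : ℂ) : sqHom (Polynomial.C r) = RatFunc.C r := by
  simp [sqHom, RatFunc.algebraMap_eq_C]

theorem sqHom_eq_expand (p : Polynomial ℂ) :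
    sqHom p = algebraMap _ _ (Polynomial.expand ℂ 2 p) := by
  induction p using Polynomial.induction_on' with
  | add p q hp hq => rw [map_add, map_add, hp, hq, map_add]
  | monomial n c =>
    rw [← Polynomial.C_mul_X_pow_eq_monomial]
    simp [RatFunc.algebraMap_X, RatFunc.algebraMap_C, sqHom_X, sqHom_C]

theorem sqHom_injective : Function.Injective sqHom := by
  intro p q h
  rw [sqHom_eq_expand, sqHom_eq_expand] at h
  exact Polynomial.expand_injective (by norm_num) (RatFunc.algebraMap_injective ℂ h)

theorem elemFun_succ (ε : ℝ) (L m : ℕ) : elemFun ε L (m + 1) =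
    elemFun ε L m * (RatFunc.X ^ 2 - const (node ε (L + m)))⁻¹ := by
  rw [elemFun, prod_range_succ, elemFun]

theorem elemFun_ne_zero (ε : ℝ) (L m : ℕ) : elemFun ε L m ≠ 0 :=
  prod_ne_zero_iff.2 fun _ _ => inv_ne_zero (X_sq_sub_const_ne_zero _)

/-- Divide `R` by `u - z_{L+M}`: the constant remainder gives a multiple of `elemFun ε L (M + 1)`,
and in the quotient term one denominator factor cancels. -/
theorem sqHom_mul_elemFun_mem_span (ε : ℝ) (L : ℕ) (M : ℕ) (R : Polynomial ℂ)
    (hR : R.natDegree ≤ M) :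
    sqHom R * elemFun ε L M ∈ Submodule.span ℂ (Set.range (elemFun ε L)) := by
  induction M generalizing R with
  | zero =>
    rw [Polynomial.eq_C_of_natDegree_le_zero hR, sqHom_C, ← RatFunc.smul_eq_C_mul]
    exact Submodule.smul_mem _ _ (Submodule.subset_span ⟨0, rfl⟩)
  | succ M ih =>
    set A : ℂ := ((node ε (L + M) : ℝ) : ℂ) with hA
    have h1 : R = Polynomial.C (R.eval A) + (Polynomial.X - Polynomial.C A) *
        (R /ₘ (Polynomial.X - Polynomial.C A)) := by
      conv_lhs => rw [← Polynomial.modByMonic_add_div R (Polynomial.X - Polynomial.C A)]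
      rw [Polynomial.modByMonic_X_sub_C_eq_C_eval]
    have h2 : (R /ₘ (Polynomial.X - Polynomial.C A)).natDegree ≤ M := by
      rw [Polynomial.natDegree_divByMonic _ (Polynomial.monic_X_sub_C A),
        Polynomial.natDegree_X_sub_C]
      omega
    have h3 := ih _ h2
    have h4 : sqHom R * elemFun ε L (M + 1) = (R.eval A) • elemFun ε L (M + 1) +
        sqHom (R /ₘ (Polynomial.X - Polynomial.C A)) * elemFun ε L M := by
      conv_lhs => rw [h1]
      rw [map_add, map_mul, map_sub, sqHom_X, sqHom_C, sqHom_C, RatFunc.smul_eq_C_mul, add_mul]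
      congr 1
      rw [elemFun_succ]
      have := X_sq_sub_const_ne_zero (node ε (L + M))
      have h5 : (RatFunc.C A : RatFunc ℂ) = const (node ε (L + M)) := rfl
      rw [h5]
      field_simp
    rw [h4]
    exact Submodule.add_mem _ (Submodule.smul_mem _ _ (Submodule.subset_span ⟨_, rfl⟩)) h3

/-- A multiple root `z` of the reduced denominator would leave a pole at `z` after multiplication by
`t - z`, the numerator being nonzero there by coprimality. -/
theorem denom_roots_nodup {ε : ℝ} {L : ℕ} {f : RatFunc ℂ} (hf : f ∈ evenSpace ε L) :
    f.denom.roots.Nodup := by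
  classical
  obtain ⟨_, _, h3, h4⟩ := hf
  rw [Multiset.nodup_iff_count_le_one]
  intro z
  rw [Polynomial.count_roots]
  by_contra hlt
  push Not at hlt
  obtain ⟨q, hq⟩ := (Polynomial.le_rootMultiplicity_iff f.denom_ne_zero).1 hlt
  have hz : f.denom.eval z = 0 := by rw [hq]; simp
  have hgrid : z ∈ grid ε L := by
    by_contra h
    exact h3 z h hz
  have hnum : f.num.eval z ≠ 0 := by
    intro h0
    obtain ⟨u, v, huv⟩ := f.isCoprime_num_denom
    have := congrArg (Polynomial.eval z) huv
    simp [h0, hz] at this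
  set g := (RatFunc.X - RatFunc.C z) * f with hg
  have hreg := h4 z hgrid
  have h5 : f.num * g.denom = g.num * ((Polynomial.X - Polynomial.C z) * q) := by
    apply RatFunc.algebraMap_injective ℂ
    have hgd := RatFunc.algebraMap_ne_zero g.denom_ne_zero
    have hfd := RatFunc.algebraMap_ne_zero f.denom_ne_zero
    have e1 : algebraMap (Polynomial ℂ) (RatFunc ℂ) g.num = g * algebraMap _ _ g.denom :=
      (div_eq_iff hgd).1 (RatFunc.num_div_denom g)
    have e2 : algebraMap (Polynomial ℂ) (RatFunc ℂ) f.num = f * algebraMap _ _ f.denom :=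
      (div_eq_iff hfd).1 (RatFunc.num_div_denom f)
    rw [map_mul, map_mul, e1, e2, hg, hq]
    simp only [map_mul, map_pow, map_sub, RatFunc.algebraMap_X, RatFunc.algebraMap_C]
    ring
  have := congrArg (Polynomial.eval z) h5
  simp only [Polynomial.eval_mul, Polynomial.eval_sub, Polynomial.eval_X, Polynomial.eval_C,
    sub_self, zero_mul, mul_zero, mul_eq_zero] at this
  exact this.elim hnum hreg

theorem exists_denom_dvd {ε : ℝ} {L : ℕ} {f : RatFunc ℂ} (hf : f ∈ evenSpace ε L) :
    ∃ M : ℕ, f.denom ∣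
      ∏ j ∈ range M, (Polynomial.X ^ 2 - Polynomial.C ((node ε (L + j) : ℝ) : ℂ)) := by
  classical
  have hroot : ∀ z ∈ f.denom.roots, ∃ m : ℕ, z ^ 2 = (node ε (L + m) : ℝ) := by
    intro z hz
    rw [← mem_grid_iff]
    by_contra h
    exact hf.2.2.1 z h ((Polynomial.mem_roots f.denom_ne_zero).1 hz)
  choose! m hm using hroot
  refine ⟨f.denom.roots.toFinset.sup m + 1, ?_⟩
  set D := ∏ j ∈ range (f.denom.roots.toFinset.sup m + 1),
    (Polynomial.X ^ 2 - Polynomial.C ((node ε (L + j) : ℝ) : ℂ)) with hD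
  have hD0 : D ≠ 0 := prod_ne_zero_iff.2 fun j _ => X_sq_sub_C_ne_zero _
  refine (IsAlgClosed.splits f.denom).dvd_of_roots_le_roots f.denom_ne_zero ?_
  rw [Multiset.le_iff_subset (denom_roots_nodup hf)]
  intro z hz
  rw [Polynomial.mem_roots hD0, Polynomial.IsRoot, hD, Polynomial.eval_prod]
  refine prod_eq_zero (i := m z) ?_ ?_
  · have : m z ≤ f.denom.roots.toFinset.sup m := le_sup (f := m) (by simpa using hz)
    simp only [mem_range]; omega
  · simp [hm z hz]

theorem eq_expand_of_comp_neg {P : Polynomial ℂ} (h : P.comp (-Polynomial.X) = P) :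
    P = Polynomial.expand ℂ 2 (Polynomial.contract 2 P) := by
  ext n
  rw [Polynomial.coeff_expand (by norm_num)]
  split_ifs with hn
  · rw [Polynomial.coeff_contract (by norm_num), Nat.div_mul_cancel hn]
  · have h1 := congrArg (fun p => Polynomial.coeff p n) h
    have h2 : (-Polynomial.X : Polynomial ℂ) = Polynomial.C (-1) * Polynomial.X := by simp
    simp only [h2, Polynomial.comp_C_mul_X_coeff] at h1
    have : (-1 : ℂ) ^ n = -1 := Odd.neg_one_pow (by
      rw [← Nat.not_even_iff_odd, even_iff_two_dvd]; exact hn)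
    rw [this] at h1
    linear_combination (-1 / 2 : ℂ) * h1

/-- Over a common denominator `∏_{j<M} (t² - z_{L+j})` the numerator is even, hence a polynomial in
`t²`; regularity at infinity bounds its degree in `t²` by `M`. -/
theorem mem_span_elemFun {ε : ℝ} {L : ℕ} {f : RatFunc ℂ} (hf : f ∈ evenSpace ε L) :
    f ∈ Submodule.span ℂ (Set.range (elemFun ε L)) := by
  by_cases hf0 : f = 0
  · rw [hf0]; exact Submodule.zero_mem _
  obtain ⟨M, hM⟩ := exists_denom_dvd hf
  set D := ∏ j ∈ range M, (Polynomial.X ^ 2 - Polynomial.C ((node ε (L + j) : ℝ) : ℂ)) with hD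
  have hD0 : D ≠ 0 := prod_ne_zero_iff.2 fun j _ => X_sq_sub_C_ne_zero _
  have hDa := RatFunc.algebraMap_ne_zero hD0
  obtain ⟨P, hP⟩ := (RatFunc.denom_dvd hD0).1 hM
  have hE : elemFun ε L M = (algebraMap _ _ D)⁻¹ := by
    rw [elemFun, hD, map_prod, prod_inv_distrib]
    simp_rw [X_sq_sub_const_eq]
  have hfD : f = algebraMap _ _ P * elemFun ε L M := by rw [hE, hP, div_eq_mul_inv]
  have hPneg : P.comp (-Polynomial.X) = P := by
    apply RatFunc.algebraMap_injective ℂ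
    rw [← negHom_algebraMap]
    have h1 : negHom f = f := hf.1
    have h2 : negHom (elemFun ε L M) = elemFun ε L M := by
      rw [elemFun, map_prod]
      exact prod_congr rfl fun j _ => by rw [map_inv₀, isEven_X_sq_sub_const]
    rw [hfD, map_mul, h2] at h1
    exact mul_right_cancel₀ (elemFun_ne_zero ε L M) h1
  have hR := eq_expand_of_comp_neg hPneg
  have hP0 : P ≠ 0 := by
    rintro rfl
    simp at hfD
    exact hf0 hfD
  have hdeg : (Polynomial.contract 2 P).natDegree ≤ M := by
    have h1 := hf.2.1
    rw [hP, RatFunc.intDegree_div (RatFunc.algebraMap_ne_zero hP0) hDa,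
      RatFunc.intDegree_polynomial, RatFunc.intDegree_polynomial] at h1
    have h2 : P.natDegree = (Polynomial.contract 2 P).natDegree * 2 := by
      conv_lhs => rw [hR]
      rw [Polynomial.natDegree_expand]
    have h3 : D.natDegree = M * 2 := by
      rw [hD, Polynomial.natDegree_prod _ _ fun j _ => X_sq_sub_C_ne_zero _]
      simp
    omega
  rw [hfD, hR, ← sqHom_eq_expand]
  exact sqHom_mul_elemFun_mem_span ε L M _ hdeg

theorem linearIndependent_elemFun (ε : ℝ) (L : ℕ) :
    LinearIndependent ℂ (elemFun ε L) := by
  rw [linearIndependent_iff']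
  have key : ∀ (M : ℕ) (c : ℕ → ℂ), ∑ m ∈ range M, c m • elemFun ε L m = 0 →
      ∀ m < M, c m = 0 := by
    intro M
    induction M with
    | zero => intro c _ m hm; omega
    | succ M ih =>
      intro c hc
      -- With all terms over the last denominator, every numerator with `m < M` contains `u -
      -- z_{L+M-1}`. Evaluation at that node isolates `c M`.
      have hmul : ∀ m ≤ M, elemFun ε L m = sqHom (∏ j ∈ Ico m M,
          (Polynomial.X - Polynomial.C ((node ε (L + j) : ℝ) : ℂ))) * elemFun ε L M := by
        intro m hm
        rw [elemFun, elemFun, ← prod_range_mul_prod_Ico _ hm, map_prod, mul_left_comm,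
          ← prod_mul_distrib]
        rw [prod_eq_one (s := Ico m M), mul_one]
        intro j _
        rw [map_sub, sqHom_X, sqHom_C]
        exact mul_inv_cancel₀ (X_sq_sub_const_ne_zero _)
      have h1 : sqHom (∑ m ∈ range (M + 1), Polynomial.C (c m) * ∏ j ∈ Ico m M,
          (Polynomial.X - Polynomial.C ((node ε (L + j) : ℝ) : ℂ))) * elemFun ε L M = 0 := by
        rw [← hc, map_sum, sum_mul]
        refine sum_congr rfl fun m hm => ?_
        rw [hmul m (by simpa [Nat.lt_succ_iff] using hm), map_mul, sqHom_C,
          RatFunc.smul_eq_C_mul, mul_assoc]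
      have h2 := (mul_eq_zero.1 h1).resolve_right (elemFun_ne_zero _ _ _)
      have h3 := sqHom_injective (h2.trans (map_zero sqHom).symm)
      have hcM : c M = 0 := by
        rcases Nat.eq_zero_or_pos M with rfl | hM
        · simpa using h3
        · have h4 := congrArg (Polynomial.eval ((node ε (L + (M - 1)) : ℝ) : ℂ)) h3
          rw [sum_range_succ, Polynomial.eval_add, Polynomial.eval_finsetSum,
            sum_eq_zero] at h4
          · simpa using h4
          · intro m hm
            rw [Polynomial.eval_mul, Polynomial.eval_prod, prod_eq_zero (i := M - 1), mul_zero]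
            · have := mem_range.1 hm
              rw [mem_Ico]; omega
            · simp
      rw [sum_range_succ, hcM, zero_smul, add_zero] at hc
      intro m hm
      rcases Nat.lt_succ_iff_lt_or_eq.1 hm with h | rfl
      · exact ih c hc m h
      · exact hcM
  classical
  intro s g hg i hi
  have h := key (s.sup id + 1) (fun m => if m ∈ s then g m else 0) (by
    rw [← hg]
    refine (sum_subset (s₁ := s) ?_ ?_).symm.trans (sum_congr rfl fun m hm => by simp [hm])
    · intro m hm
      have : m ≤ s.sup id := le_sup (f := id) hm
      simp only [mem_range]; omega
    · intro m _ hm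
      simp [hm]) i (by
        have : i ≤ s.sup id := le_sup (f := id) hi
        omega)
  simpa [hi] using h

/-! ### Jacobi polynomials as eigenfunctions -/

section Orthogonality

open MeasureTheory

theorem intervalIntegrable_weight {a b : ℝ} (ha : -1 < a) (hb : -1 < b) :
    IntervalIntegrable (fun x : ℝ => (1 - x) ^ a * (1 + x) ^ b) volume (-1) 1 := by
  have h1 : IntervalIntegrable (fun x : ℝ => (1 - x) ^ a * (1 + x) ^ b) volume 0 1 := by
    apply IntervalIntegrable.mul_continuousOn
    · have := (intervalIntegral.intervalIntegrable_rpow' (a := 1) (b := 0) ha).comp_sub_left 1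
      simpa using this
    · apply ContinuousOn.rpow_const (by fun_prop)
      intro x hx
      rw [Set.uIcc_of_le zero_le_one] at hx
      left; linarith [hx.1]
  have h2 : IntervalIntegrable (fun x : ℝ => (1 - x) ^ a * (1 + x) ^ b) volume (-1) 0 := by
    apply IntervalIntegrable.continuousOn_mul
    · have := (intervalIntegral.intervalIntegrable_rpow' (a := 0) (b := 1) hb).comp_add_left 1
      simpa using this
    · apply ContinuousOn.rpow_const (by fun_prop)
      intro x hx
      rw [Set.uIcc_of_le (by norm_num)] at hx
      left; linarith [hx.2]
  exact h2.trans h1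

theorem intervalIntegrable_eval_mul_weight {a b : ℝ} (ha : -1 < a) (hb : -1 < b)
    (p : Polynomial ℝ) :
    IntervalIntegrable (fun x : ℝ => p.eval x * ((1 - x) ^ a * (1 + x) ^ b)) volume (-1) 1 :=
  (intervalIntegrable_weight ha hb).continuousOn_mul p.continuous.continuousOn

/-- The moment functional of the weight `(1 - x)^a (1 + x)^b`. -/
def moment {a b : ℝ} (ha : -1 < a) (hb : -1 < b) : Polynomial ℝ →ₗ[ℝ] ℝ where
  toFun p := ∫ x in (-1 : ℝ)..1, p.eval x * ((1 - x) ^ a * (1 + x) ^ b)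
  map_add' p q := by
    rw [← intervalIntegral.integral_add (intervalIntegrable_eval_mul_weight ha hb p)
      (intervalIntegrable_eval_mul_weight ha hb q)]
    simp [add_mul]
  map_smul' r p := by
    simp [mul_assoc]

theorem jacobiInner_eq {a b : ℝ} (ha : -1 < a) (hb : -1 < b) (p q : Polynomial ℝ) :
    jacobiInner a b p q = moment ha hb (p * q) := by
  simp [jacobiInner, moment]

theorem moment_sq_pos {a b : ℝ} (ha : -1 < a) (hb : -1 < b) {p : Polynomial ℝ} (hp : p ≠ 0) :
    0 < moment ha hb (p * p) := by
  have hint := intervalIntegrable_eval_mul_weight ha hb (p * p)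
  change 0 < ∫ x in (-1 : ℝ)..1, (p * p).eval x * ((1 - x) ^ a * (1 + x) ^ b)
  rw [intervalIntegral.integral_pos_iff_support_of_nonneg_ae' _ hint]
  · refine ⟨by norm_num, ?_⟩
    have hsub : Set.Ioo (-1 : ℝ) 1 \ (p.roots.toFinset : Set ℝ) ⊆
        (Function.support fun x : ℝ => (p * p).eval x * ((1 - x) ^ a * (1 + x) ^ b)) ∩
          Set.Ioc (-1) 1 := by
      rintro x ⟨hx, hr⟩
      refine ⟨?_, hx.1, hx.2.le⟩
      have h1 : p.eval x ≠ 0 := by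
        simpa [hp] using hr
      have h2 : (0 : ℝ) < (1 - x) ^ a := Real.rpow_pos_of_pos (by linarith [hx.2]) _
      have h3 : (0 : ℝ) < (1 + x) ^ b := Real.rpow_pos_of_pos (by linarith [hx.1]) _
      simp only [Function.mem_support, Polynomial.eval_mul]
      positivity
    refine lt_of_lt_of_le ?_ (measure_mono hsub)
    rw [measure_sdiff_null (p.roots.toFinset.finite_toSet.measure_zero volume)]
    simp
  · rw [Set.uIoc_of_le (by norm_num)]
    refine (ae_restrict_iff' measurableSet_Ioc).2 (Filter.Eventually.of_forall fun x hx => ?_)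
    have h2 : (0 : ℝ) ≤ (1 - x) ^ a := Real.rpow_nonneg (by linarith [hx.2]) _
    have h3 : (0 : ℝ) ≤ (1 + x) ^ b := Real.rpow_nonneg (by linarith [hx.1]) _
    simp only [Pi.zero_apply, Polynomial.eval_mul]
    exact mul_nonneg (mul_self_nonneg _) (mul_nonneg h2 h3)

/-- The integrand is the derivative of `(1 - x)^{a+1} (1 + x)^{b+1} p`, which vanishes at both
endpoints because `a + 1` and `b + 1` are positive. -/
theorem moment_pearson {a b : ℝ} (ha : -1 < a) (hb : -1 < b) (p : Polynomial ℝ) :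
    moment ha hb ((1 - Polynomial.X ^ 2) * Polynomial.derivative p +
      (Polynomial.C (b - a) - Polynomial.C (a + b + 2) * Polynomial.X) * p) = 0 := by
  have hint := intervalIntegrable_eval_mul_weight ha hb
    ((1 - Polynomial.X ^ 2) * Polynomial.derivative p +
      (Polynomial.C (b - a) - Polynomial.C (a + b + 2) * Polynomial.X) * p)
  have h := intervalIntegral.integral_eq_sub_of_hasDerivAt_of_le (a := (-1 : ℝ)) (b := 1)
    (f := fun x : ℝ => (1 - x) ^ (a + 1) * (1 + x) ^ (b + 1) * p.eval x) (by norm_num)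
    ?_ ?_ hint
  · refine h.trans ?_
    simp [Real.zero_rpow (by linarith : a + 1 ≠ 0), Real.zero_rpow (by linarith : b + 1 ≠ 0)]
  · refine ContinuousOn.mul (ContinuousOn.mul ?_ ?_) p.continuous.continuousOn
    · exact ContinuousOn.rpow_const (by fun_prop) fun x _ => Or.inr (by linarith)
    · exact ContinuousOn.rpow_const (by fun_prop) fun x _ => Or.inr (by linarith)
  · intro x hx
    have hx1 : 0 < 1 - x := by linarith [hx.2]
    have hx2 : 0 < 1 + x := by linarith [hx.1]
    have d1 : HasDerivAt (fun x : ℝ => (1 - x) ^ (a + 1)) (-1 * (a + 1) * (1 - x) ^ (a + 1 - 1)) x :=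
      ((hasDerivAt_id x).const_sub 1).rpow_const (Or.inl hx1.ne')
    have d2 : HasDerivAt (fun x : ℝ => (1 + x) ^ (b + 1)) (1 * (b + 1) * (1 + x) ^ (b + 1 - 1)) x :=
      ((hasDerivAt_id x).const_add 1).rpow_const (Or.inl hx2.ne')
    have d3 := (d1.mul d2).mul (p.hasDerivAt x)
    refine d3.congr_deriv ?_
    simp only [add_sub_cancel_right, Real.rpow_add_one hx1.ne', Real.rpow_add_one hx2.ne',
      Polynomial.eval_add, Polynomial.eval_mul, Polynomial.eval_sub, Polynomial.eval_one,
      Polynomial.eval_pow, Polynomial.eval_X, Polynomial.eval_C, Pi.mul_apply]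
    ring

/-- The Jacobi differential operator. -/
def jacobiOp (a b : ℝ) : Polynomial ℝ →ₗ[ℝ] Polynomial ℝ where
  toFun p := (1 - Polynomial.X ^ 2) * Polynomial.derivative (Polynomial.derivative p) +
    (Polynomial.C (b - a) - Polynomial.C (a + b + 2) * Polynomial.X) * Polynomial.derivative p
  map_add' p q := by simp only [map_add]; ring
  map_smul' r p := by
    simp only [Polynomial.derivative_smul, RingHom.id_apply, smul_add, mul_smul_comm]

/-- Integration by parts: `moment_pearson` for `p' q`. The right side is symmetric in `p` and `q`,
so the operator is self-adjoint. -/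
theorem moment_jacobiOp_mul {a b : ℝ} (ha : -1 < a) (hb : -1 < b) (p q : Polynomial ℝ) :
    moment ha hb (jacobiOp a b p * q) = -moment ha hb ((1 - Polynomial.X ^ 2) *
      (Polynomial.derivative p * Polynomial.derivative q)) := by
  rw [eq_neg_iff_add_eq_zero, ← map_add, ← moment_pearson ha hb (Polynomial.derivative p * q)]
  congr 1
  simp only [jacobiOp, LinearMap.coe_mk, AddHom.coe_mk, Polynomial.derivative_mul]
  ring

theorem moment_mul_eq_zero_of_eigen {a b : ℝ} (ha : -1 < a) (hb : -1 < b) {p q : Polynomial ℝ}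
    {r s : ℝ} (hp : jacobiOp a b p = r • p) (hq : jacobiOp a b q = s • q) (hrs : r ≠ s) :
    moment ha hb (p * q) = 0 := by
  have h1 := moment_jacobiOp_mul ha hb p q
  have h2 := moment_jacobiOp_mul ha hb q p
  rw [hp, smul_mul_assoc, map_smul, smul_eq_mul] at h1
  rw [hq, smul_mul_assoc, map_smul, smul_eq_mul, mul_comm q p,
    mul_comm (Polynomial.derivative q)] at h2
  have : (r - s) * moment ha hb (p * q) = 0 := by linarith
  exact (mul_eq_zero.1 this).resolve_left (sub_ne_zero.2 hrs)

theorem exists_sum_of_degree_lt {M : ℕ → Polynomial ℝ} (hmonic : ∀ n, (M n).Monic)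
    (hdeg : ∀ n, (M n).natDegree = n) (n : ℕ) (p : Polynomial ℝ) (hp : p.degree < n) :
    ∃ α : ℕ → ℝ, p = ∑ k ∈ range n, α k • M k := by
  induction n generalizing p with
  | zero =>
    refine ⟨0, ?_⟩
    have : p = 0 := by simpa [Polynomial.degree_lt_iff_coeff_zero, Polynomial.ext_iff] using hp
    simp [this]
  | succ n ih =>
    obtain ⟨α, hα⟩ := ih (p - p.coeff n • M n) (by
      rw [Polynomial.degree_lt_iff_coeff_zero] at hp ⊢
      intro m hm
      rcases hm.eq_or_lt with rfl | h
      · have : (M n).coeff n = 1 := by simpa [hdeg] using (hmonic n).coeff_natDegree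
        simp [this]
      · rw [Polynomial.coeff_sub, hp m h, Polynomial.coeff_smul,
          Polynomial.coeff_eq_zero_of_natDegree_lt (p := M n) (by rwa [hdeg])]
        simp)
    refine ⟨Function.update α n (p.coeff n), ?_⟩
    rw [sum_range_succ, Function.update_self, sum_congr rfl fun k hk => by
      rw [Function.update_of_ne (mem_range.1 hk).ne], ← hα]
    abel

/-- Uniqueness of Gram–Schmidt: the projection coefficients of `x^n` on the lower `M_k` are the
coefficients of `x^n - M_n` in the `M_k`. -/
theorem jacobiMonic_eq_of_orthogonal {a b : ℝ} (ha : -1 < a) (hb : -1 < b)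
    {M : ℕ → Polynomial ℝ} (hmonic : ∀ n, (M n).Monic) (hdeg : ∀ n, (M n).natDegree = n)
    (horth : ∀ i j, i ≠ j → moment ha hb (M i * M j) = 0) (n : ℕ) :
    jacobiMonic a b n = M n := by
  induction n using Nat.strong_induction_on with
  | _ n ih =>
    obtain ⟨α, hα⟩ := exists_sum_of_degree_lt hmonic hdeg n (Polynomial.X ^ n - M n) (by
      have h := Polynomial.degree_sub_lt_left (p := (Polynomial.X ^ n : Polynomial ℝ)) (q := M n)
        (by rw [Polynomial.degree_X_pow, Polynomial.degree_eq_natDegree (hmonic n).ne_zero, hdeg])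
        (by simp) (by rw [(Polynomial.monic_X_pow n).leadingCoeff, (hmonic n).leadingCoeff])
      simpa using h)
    have hX : (Polynomial.X ^ n : Polynomial ℝ) = M n + ∑ k ∈ range n, α k • M k := by
      rw [← hα]; ring
    rw [jacobiMonic, Fin.sum_univ_eq_sum_range (fun k => Polynomial.C
      (jacobiInner a b (Polynomial.X ^ n) (jacobiMonic a b k) /
        jacobiInner a b (jacobiMonic a b k) (jacobiMonic a b k)) * jacobiMonic a b k) n]
    have hterm : ∀ k ∈ range n, Polynomial.C
      (jacobiInner a b (Polynomial.X ^ n) (jacobiMonic a b k) /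
        jacobiInner a b (jacobiMonic a b k) (jacobiMonic a b k)) * jacobiMonic a b k =
        α k • M k := by
      intro k hk
      have hkn := mem_range.1 hk
      rw [ih k hkn, jacobiInner_eq ha hb, jacobiInner_eq ha hb, Polynomial.smul_eq_C_mul]
      congr 2
      rw [div_eq_iff (moment_sq_pos ha hb (hmonic k).ne_zero).ne', hX, add_mul, map_add,
        horth n k hkn.ne', zero_add, sum_mul, map_sum, sum_eq_single k]
      · rw [smul_mul_assoc, map_smul, smul_eq_mul]
      · intro j _ hj
        rw [smul_mul_assoc, map_smul, horth j k hj, smul_zero]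
      · intro h; exact absurd hk h
    rw [sum_congr rfl hterm, hX]
    ring

end Orthogonality

/-! ### The explicit polynomials -/

/-- The Newton basis polynomials `(u - z_0) ⋯ (u - z_{m-1})`. -/
def newton (z : ℕ → ℝ) (m : ℕ) : Polynomial ℝ := ∏ j ∈ range m, (Polynomial.X - Polynomial.C (z j))

theorem newton_monic (z : ℕ → ℝ) (m : ℕ) : (newton z m).Monic :=
  Polynomial.monic_prod_of_monic _ _ fun _ _ => Polynomial.monic_X_sub_C _

theorem natDegree_newton (z : ℕ → ℝ) (m : ℕ) : (newton z m).natDegree = m := by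
  rw [newton, Polynomial.natDegree_prod_of_monic _ _ fun j _ => Polynomial.monic_X_sub_C (z j)]
  simp

theorem eval_newton (z : ℕ → ℝ) (m : ℕ) (s : ℝ) :
    (newton z m).eval s = ∏ j ∈ range m, (s - z j) := by
  simp [newton, Polynomial.eval_prod]

theorem eval_newton_succ (z : ℕ → ℝ) (m : ℕ) (s : ℝ) :
    (newton z (m + 1)).eval s = (newton z m).eval s * (s - z m) := by
  rw [eval_newton, prod_range_succ, eval_newton]

theorem eval_newton_eq_zero (z : ℕ → ℝ) {m n : ℕ} (h : n < m) : (newton z m).eval (z n) = 0 := by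
  rw [eval_newton]
  exact prod_eq_zero (mem_range.2 h) (sub_self _)

theorem eval_newton_self_ne_zero {z : ℕ → ℝ} (hz : StrictMono z) (n : ℕ) :
    (newton z n).eval (z n) ≠ 0 := by
  rw [eval_newton, prod_ne_zero_iff]
  intro j hj
  exact sub_ne_zero.2 (hz (mem_range.1 hj)).ne'

/-- The polynomial `∑_m c_m (z_n - z_0) ⋯ (z_n - z_{m-1}) (x - 1)^m`. -/
def newtonSum (z c : ℕ → ℝ) (n : ℕ) : Polynomial ℝ :=
  ∑ m ∈ range (n + 1), (c m * (newton z m).eval (z n)) • (Polynomial.X - 1) ^ m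

theorem newtonSum_eq_sum_of_lt (z c : ℕ → ℝ) {n M : ℕ} (h : n < M) : newtonSum z c n =
    ∑ m ∈ range M, (c m * (newton z m).eval (z n)) • (Polynomial.X - 1) ^ m := by
  refine sum_subset (fun m hm => ?_) fun m _ hm => ?_
  · simp only [mem_range] at hm ⊢; omega
  · rw [eval_newton_eq_zero z (by simpa using hm), mul_zero, zero_smul]

theorem newtonSum_eval_one (z c : ℕ → ℝ) (n : ℕ) : (newtonSum z c n).eval 1 = c 0 := by
  rw [newtonSum, sum_range_succ', Polynomial.eval_add, Polynomial.eval_finsetSum, sum_eq_zero]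
  · simp [newton]
  · intro m _
    simp

theorem natDegree_X_sub_one_pow (m : ℕ) :
    ((Polynomial.X - 1 : Polynomial ℝ) ^ m).natDegree = m := by
  rw [← Polynomial.C_1, Polynomial.natDegree_pow, Polynomial.natDegree_X_sub_C, mul_one]

theorem coeff_newtonSum_self (z c : ℕ → ℝ) (n : ℕ) :
    (newtonSum z c n).coeff n = c n * (newton z n).eval (z n) := by
  rw [newtonSum, sum_range_succ, Polynomial.coeff_add, Polynomial.finsetSum_coeff, sum_eq_zero]
  · have h : ((Polynomial.X - 1 : Polynomial ℝ) ^ n).coeff n = 1 := by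
      have h1 : ((Polynomial.X - 1 : Polynomial ℝ) ^ n).Monic := by
        rw [← Polynomial.C_1]; exact (Polynomial.monic_X_sub_C 1).pow n
      have := h1.coeff_natDegree
      rwa [natDegree_X_sub_one_pow] at this
    simp [h]
  · intro m hm
    rw [Polynomial.coeff_smul, Polynomial.coeff_eq_zero_of_natDegree_lt
      (by rw [natDegree_X_sub_one_pow]; exact mem_range.1 hm), smul_zero]

theorem natDegree_newtonSum_le (z c : ℕ → ℝ) (n : ℕ) : (newtonSum z c n).natDegree ≤ n := by
  refine Polynomial.natDegree_sum_le_of_forall_le _ _ fun m hm => ?_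
  refine (Polynomial.natDegree_smul_le _ _).trans ?_
  rw [natDegree_X_sub_one_pow]
  exact Nat.lt_succ_iff.1 (mem_range.1 hm)

theorem natDegree_newtonSum {z c : ℕ → ℝ} (hz : StrictMono z) (hc : ∀ m, c m ≠ 0) (n : ℕ) :
    (newtonSum z c n).natDegree = n :=
  Polynomial.natDegree_eq_of_le_of_coeff_ne_zero (natDegree_newtonSum_le z c n) (by
    rw [coeff_newtonSum_self]
    exact mul_ne_zero (hc n) (eval_newton_self_ne_zero hz n))

theorem leadingCoeff_newtonSum {z c : ℕ → ℝ} (hz : StrictMono z) (hc : ∀ m, c m ≠ 0) (n : ℕ) :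
    (newtonSum z c n).leadingCoeff = c n * (newton z n).eval (z n) := by
  rw [Polynomial.leadingCoeff, natDegree_newtonSum hz hc, coeff_newtonSum_self]

/-! ### The Jacobi eigenvalue equation in powers of `x - 1`. -/

/-- The coefficients `1 / ((a+1)_m m! 2^m)`. -/
def jacCoeff (a : ℝ) (m : ℕ) : ℝ :=
  ((ascPochhammer ℝ m).eval (a + 1) * (m.factorial : ℝ) * 2 ^ m)⁻¹

theorem ascPochhammer_eval_add_one_pos {a : ℝ} (ha : -1 < a) (m : ℕ) :
    0 < (ascPochhammer ℝ m).eval (a + 1) :=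
  ascPochhammer_pos m _ (by linarith)

theorem jacCoeff_pos {a : ℝ} (ha : -1 < a) (m : ℕ) : 0 < jacCoeff a m := by
  have := ascPochhammer_eval_add_one_pos ha m
  unfold jacCoeff
  positivity

theorem jacCoeff_succ {a : ℝ} (ha : -1 < a) (m : ℕ) :
    jacCoeff a (m + 1) * (2 * (m + 1) * (m + 1 + a)) = jacCoeff a m := by
  have h1 := (ascPochhammer_eval_add_one_pos ha m).ne'
  have h2 : (a + 1 + m : ℝ) ≠ 0 := by
    have : (0 : ℝ) ≤ m := by positivity
    linarith
  have h3 : (m.factorial : ℝ) ≠ 0 := by positivity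
  have h4 : (m + 1 : ℝ) ≠ 0 := by positivity
  rw [jacCoeff, jacCoeff, ascPochhammer_succ_eval, Nat.factorial_succ, pow_succ]
  push_cast
  field_simp
  ring

/-- Since `1 - x² = -(x - 1)² - 2(x - 1)`, the operator is bidiagonal in powers of `x - 1`. Its
diagonal entry is `-m(m + a + b + 1) = -(z_m - z_0)`, whence the nodes. -/
theorem jacobiOp_X_sub_one_pow (a b : ℝ) (m : ℕ) :
    jacobiOp a b ((Polynomial.X - 1) ^ m) =
      -(((node (eps a b) m - node (eps a b) 0) • (Polynomial.X - 1) ^ m) +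
        (2 * m * (m + a)) • (Polynomial.X - 1) ^ (m - 1)) := by
  have hd : ∀ k : ℕ, Polynomial.derivative ((Polynomial.X - 1 : Polynomial ℝ) ^ k) =
      Polynomial.C (k : ℝ) * (Polynomial.X - 1) ^ (k - 1) := by
    intro k
    rw [Polynomial.derivative_pow]
    simp
  simp only [jacobiOp, LinearMap.coe_mk, AddHom.coe_mk, hd, Polynomial.derivative_C_mul,
    Polynomial.smul_eq_C_mul]
  have hn : node (eps a b) m - node (eps a b) 0 = m * (m + a + b + 1) := by
    simp only [node, eps]; push_cast; ring
  rw [hn]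
  rcases m with _ | _ | m
  · simp
  · simp only [zero_add, Nat.sub_self, pow_zero, pow_one, map_mul, map_add, map_sub, Nat.cast_zero,
      Nat.cast_one, map_one, Polynomial.C_ofNat, map_zero]
    ring
  · simp only [Nat.add_sub_cancel, show m + 1 + 1 - 1 = m + 1 from rfl, map_mul, map_add, map_sub,
      Nat.cast_add, Nat.cast_one, map_one, Polynomial.C_ofNat, map_natCast]
    ring

theorem jacobiOp_newtonSum {a : ℝ} (ha : -1 < a) (b : ℝ) (n : ℕ) :
    jacobiOp a b (newtonSum (node (eps a b)) (jacCoeff a) n) =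
      (-(node (eps a b) n - node (eps a b) 0)) • newtonSum (node (eps a b)) (jacCoeff a) n := by
  set z := node (eps a b)
  set c := jacCoeff a
  -- By the recursion for `c_m`, the lowered terms contribute `z_n - z_m` to the coefficient at `(x
  -- - 1)^m`; added to `z_m - z_0` this is the eigenvalue.
  have h1 : ∑ m ∈ range (n + 1), (c m * (newton z m).eval (z n)) •
      ((2 * (m : ℝ) * (m + a)) • (Polynomial.X - 1 : Polynomial ℝ) ^ (m - 1)) =
      ∑ m ∈ range (n + 1), (c m * (newton z m).eval (z n)) •
        ((z n - z m) • (Polynomial.X - 1 : Polynomial ℝ) ^ m) := by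
    rw [sum_range_succ', sum_range_succ]
    simp only [Nat.cast_zero, mul_zero, zero_mul, zero_smul, smul_zero, sub_self, add_zero]
    refine sum_congr rfl fun m _ => ?_
    rw [smul_smul, smul_smul, eval_newton_succ, Nat.add_sub_cancel]
    congr 1
    have := jacCoeff_succ ha m
    change c (m + 1) * (2 * (m + 1) * (m + 1 + a)) = c m at this
    push_cast
    rw [← this]
    ring
  rw [newtonSum, map_sum, smul_sum]
  simp only [map_smul, jacobiOp_X_sub_one_pow, smul_neg, smul_add]
  rw [sum_neg_distrib, sum_add_distrib, h1, ← sum_add_distrib, ← sum_neg_distrib]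
  refine sum_congr rfl fun m _ => ?_
  simp only [smul_smul, ← add_smul, ← neg_smul]
  congr 1
  change -(c m * (newton z m).eval (z n) * (z m - z 0) +
    c m * (newton z m).eval (z n) * (z n - z m)) = _
  ring

/-- For `ε ≥ 0` the nodes increase strictly, so the eigenvalues are distinct and the
eigenpolynomials orthogonal. The normalization is read off at `x = 1`, where the Newton sum equals
`c_0 = 1`. -/
theorem jacobiP_eq {a b : ℝ} (ha : -1 < a) (hb : -1 < b) (hab : -1 ≤ a + b) (n : ℕ) :
    jacobiP a b n = ((ascPochhammer ℝ n).eval (a + 1) / (n.factorial : ℝ)) •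
      newtonSum (node (eps a b)) (jacCoeff a) n := by
  have hε : 0 ≤ eps a b := by unfold eps; linarith
  have hz := node_strictMono hε
  have hc : ∀ m, jacCoeff a m ≠ 0 := fun m => (jacCoeff_pos ha m).ne'
  set z := node (eps a b)
  set c := jacCoeff a
  have hl : ∀ n, c n * (newton z n).eval (z n) ≠ 0 := fun n =>
    mul_ne_zero (hc n) (eval_newton_self_ne_zero hz n)
  have hM : ∀ n, jacobiMonic a b n = (c n * (newton z n).eval (z n))⁻¹ • newtonSum z c n := by
    apply jacobiMonic_eq_of_orthogonal ha hb
    · intro n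
      rw [Polynomial.Monic, Polynomial.smul_eq_C_mul, Polynomial.leadingCoeff_mul,
        Polynomial.leadingCoeff_C, leadingCoeff_newtonSum hz hc, inv_mul_cancel₀ (hl n)]
    · intro n
      rw [Polynomial.natDegree_smul _ (inv_ne_zero (hl n)), natDegree_newtonSum hz hc]
    · intro i j hij
      rw [smul_mul_smul_comm, map_smul, moment_mul_eq_zero_of_eigen ha hb
        (jacobiOp_newtonSum ha b i) (jacobiOp_newtonSum ha b j), smul_zero]
      intro h
      exact hij (hz.injective (by linarith : z i = z j))
  have hc0 : c 0 = 1 := by simp [c, jacCoeff]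
  rw [jacobiP, hM, Polynomial.eval_smul, newtonSum_eval_one, hc0, smul_eq_mul, mul_one, div_inv_eq_mul,
    ← Polynomial.smul_eq_C_mul, smul_smul, mul_assoc, mul_inv_cancel₀ (hl n), mul_one]

/-! ### The pairing on functions of the nodes -/

/-- The polynomial `∏_{q<j<N} (u - z_j)`. -/
def tailPoly (z : ℕ → ℝ) (N q : ℕ) : Polynomial ℝ :=
  ∏ j ∈ Ico (q + 1) N, (Polynomial.X - Polynomial.C (z j))

theorem tailPoly_monic (z : ℕ → ℝ) (N q : ℕ) : (tailPoly z N q).Monic :=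
  Polynomial.monic_prod_of_monic _ _ fun _ _ => Polynomial.monic_X_sub_C _

theorem natDegree_tailPoly (z : ℕ → ℝ) (N q : ℕ) :
    (tailPoly z N q).natDegree = N - (q + 1) := by
  rw [tailPoly, Polynomial.natDegree_prod_of_monic _ _ fun j _ => Polynomial.monic_X_sub_C (z j)]
  simp

/-- The barycentric weights of the nodes `z_{n_i}`. -/
def baryWeight (z : ℕ → ℝ) {N : ℕ} (n : Fin N → ℕ) (i : Fin N) : ℝ :=
  Lagrange.nodalWeight univ (fun i => z (n i)) i

/-- The pairing `∑_i w_i φ(z_{n_i}) ψ(z_{n_i})` of polynomials. -/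
def pairing (z : ℕ → ℝ) {N : ℕ} (n : Fin N → ℕ) (φ ψ : Polynomial ℝ) : ℝ :=
  ∑ i, baryWeight z n i * φ.eval (z (n i)) * ψ.eval (z (n i))

/-- The pairing is the divided difference of `φψ` at `N` nodes, which in degree below `N` is the
coefficient of `u^{N-1}`. -/
theorem pairing_eq_coeff {z : ℕ → ℝ} (hz : StrictMono z) {N : ℕ} {n : Fin N → ℕ}
    (hn : Function.Injective n) {φ ψ : Polynomial ℝ} (h : (φ * ψ).degree < N) :
    pairing z n φ ψ = (φ * ψ).coeff (N - 1) := by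
  have := Lagrange.coeff_eq_sum (s := univ) (v := fun i => z (n i))
    (hz.injective.comp hn).injOn (P := φ * ψ) (by simpa using h)
  rw [card_univ, Fintype.card_fin] at this
  rw [this, pairing]
  refine sum_congr rfl fun i _ => ?_
  rw [baryWeight, Lagrange.nodalWeight, prod_inv_distrib, Polynomial.eval_mul]
  ring

theorem degree_tailPoly_mul_newton_lt (z : ℕ → ℝ) {N q m : ℕ} (hq : q < N) (hm : m ≤ q) :
    (tailPoly z N q * newton z m).degree < N := by
  rw [Polynomial.degree_eq_natDegree ((tailPoly_monic z N q).mul (newton_monic z m)).ne_zero,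
    (tailPoly_monic z N q).natDegree_mul (newton_monic z m), natDegree_tailPoly,
    natDegree_newton]
  exact_mod_cast (by omega : N - (q + 1) + m < N)

theorem pairing_tailPoly_newton_of_lt {z : ℕ → ℝ} (hz : StrictMono z) {N : ℕ} {n : Fin N → ℕ}
    (hn : Function.Injective n) {q m : ℕ} (hq : q < N) (hm : m < q) :
    pairing z n (tailPoly z N q) (newton z m) = 0 := by
  rw [pairing_eq_coeff hz hn (degree_tailPoly_mul_newton_lt z hq hm.le)]
  apply Polynomial.coeff_eq_zero_of_natDegree_lt
  rw [(tailPoly_monic z N q).natDegree_mul (newton_monic z m), natDegree_tailPoly,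
    natDegree_newton]
  omega

theorem pairing_tailPoly_newton_self {z : ℕ → ℝ} (hz : StrictMono z) {N : ℕ} {n : Fin N → ℕ}
    (hn : Function.Injective n) {q : ℕ} (hq : q < N) :
    pairing z n (tailPoly z N q) (newton z q) = 1 := by
  rw [pairing_eq_coeff hz hn (degree_tailPoly_mul_newton_lt z hq le_rfl)]
  have h := ((tailPoly_monic z N q).mul (newton_monic z q)).coeff_natDegree
  rw [(tailPoly_monic z N q).natDegree_mul (newton_monic z q), natDegree_tailPoly,
    natDegree_newton] at h
  rwa [show N - 1 = N - (q + 1) + q by omega]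

/-- The polynomials `h_q` with `∑_i w_i φ_q(z_{n_i}) Q_{n_i} = (x - 1)^q h_q`, where
`φ_q = ∏_{q<j<N} (u - z_j)`; here `M` is any bound for the `n_i`. -/
def flagPoly (z c : ℕ → ℝ) {N : ℕ} (n : Fin N → ℕ) (M q : ℕ) : Polynomial ℝ :=
  ∑ m ∈ Ico q M, (c m * pairing z n (tailPoly z N q) (newton z m)) •
    (Polynomial.X - 1) ^ (m - q)

/-- On the left, `(x - 1)^m` has coefficient `c_m` times the pairing of `φ_q` with the `m`-th Newton
polynomial. This product has degree `N - 1 - q + m`, so the pairing vanishes for `m < q`. -/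
theorem sum_baryWeight_smul_newtonSum {z : ℕ → ℝ} (hz : StrictMono z) (c : ℕ → ℝ) {N : ℕ}
    {n : Fin N → ℕ} (hn : Function.Injective n) {M : ℕ} (hM : ∀ i, n i < M) (hNM : N ≤ M)
    {q : ℕ} (hq : q < N) :
    ∑ i, (baryWeight z n i * (tailPoly z N q).eval (z (n i))) • newtonSum z c (n i) =
      (Polynomial.X - 1) ^ q * flagPoly z c n M q := by
  have h1 : ∑ i, (baryWeight z n i * (tailPoly z N q).eval (z (n i))) • newtonSum z c (n i) =
      ∑ m ∈ range M, (c m * pairing z n (tailPoly z N q) (newton z m)) •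
        (Polynomial.X - 1 : Polynomial ℝ) ^ m := by
    simp only [newtonSum_eq_sum_of_lt z c (hM _), smul_sum]
    rw [sum_comm]
    refine sum_congr rfl fun m _ => ?_
    simp only [smul_smul]
    rw [← sum_smul, pairing, mul_sum]
    congr 1
    exact sum_congr rfl fun i _ => by ring
  rw [h1, flagPoly, mul_sum, ← sum_range_add_sum_Ico _ (hq.le.trans hNM), sum_eq_zero, zero_add]
  · refine sum_congr rfl fun m hm => ?_
    rw [mul_smul_comm, ← pow_add, Nat.add_sub_cancel' (mem_Ico.1 hm).1]
  · intro m hm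
    rw [pairing_tailPoly_newton_of_lt hz hn hq (mem_range.1 hm), mul_zero, zero_smul]

theorem flagPoly_eval_one {z : ℕ → ℝ} (hz : StrictMono z) (c : ℕ → ℝ) {N : ℕ}
    {n : Fin N → ℕ} (hn : Function.Injective n) {M : ℕ} (hNM : N ≤ M) {q : ℕ} (hq : q < N) :
    (flagPoly z c n M q).eval 1 = c q := by
  rw [flagPoly, Polynomial.eval_finsetSum, sum_eq_single q]
  · simp [pairing_tailPoly_newton_self hz hn hq]
  · intro m hm hmq
    have : m - q ≠ 0 := by have := (mem_Ico.1 hm).1; omega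
    simp [this]
  · intro h
    exact absurd (mem_Ico.2 ⟨le_rfl, hq.trans_le hNM⟩) h

/-- The matrix `[w_j φ_{N-i}(z_{n_j})]`. -/
def baryMatrix (z : ℕ → ℝ) {N : ℕ} (n : Fin N → ℕ) : Matrix (Fin N) (Fin N) ℝ :=
  Matrix.of fun i j => baryWeight z n j * (tailPoly z N i.rev).eval (z (n j))

/-- `∏_{i<j} (z_{n_i} - z_{n_j})`. -/
def nodeVandermonde (z : ℕ → ℝ) {N : ℕ} (n : Fin N → ℕ) : ℝ :=
  ∏ p : Fin N × Fin N with p.1 < p.2, (z (n p.1) - z (n p.2))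

theorem nodeVandermonde_ne_zero {z : ℕ → ℝ} (hz : StrictMono z) {N : ℕ} {n : Fin N → ℕ}
    (hn : Function.Injective n) : nodeVandermonde z n ≠ 0 := by
  rw [nodeVandermonde, prod_ne_zero_iff]
  rintro ⟨i, j⟩ h
  simp only [mem_filter, mem_univ, true_and] at h
  exact sub_ne_zero.2 fun h2 => h.ne (hn (hz.injective h2))

/-- The Vandermonde product is also the determinant of Newton polynomials at the nodes. The product
of the two matrices consists of pairings and is triangular with unit diagonal. -/
theorem det_baryMatrix_mul {z : ℕ → ℝ} (hz : StrictMono z) {N : ℕ} {n : Fin N → ℕ}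
    (hn : Function.Injective n) : (baryMatrix z n).det * nodeVandermonde z n = 1 := by
  rw [nodeVandermonde, ← det_eval_monic_rev (fun i => z (n i)) (newton z) (natDegree_newton z)
    (newton_monic z), ← Matrix.det_mul]
  have he : ∀ i j, (baryMatrix z n * Matrix.of fun i j : Fin N =>
      (newton z (j.rev : ℕ)).eval (z (n i))) i j =
      pairing z n (tailPoly z N i.rev) (newton z j.rev) := by
    intro i j
    rw [Matrix.mul_apply, pairing]
    rfl
  rw [Matrix.det_of_isLowerTriangular]
  · refine prod_eq_one fun i _ => ?_
    rw [he, pairing_tailPoly_newton_self hz hn i.rev.isLt]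
  · intro i j hij
    rw [he, pairing_tailPoly_newton_of_lt hz hn i.rev.isLt]
    exact Fin.rev_lt_rev.2 hij

/-- The matrix `[Q_{n_i}(X_j)]`. -/
def newtonSumMatrix (z c : ℕ → ℝ) {N : ℕ} (n : Fin N → ℕ) :
    Matrix (Fin N) (Fin N) (MvPolynomial (Fin N) ℝ) :=
  Matrix.of fun i j => Polynomial.aeval (MvPolynomial.X j : MvPolynomial (Fin N) ℝ)
    (newtonSum z c (n i))

theorem det_newtonSumMatrix {z : ℕ → ℝ} (hz : StrictMono z) (c : ℕ → ℝ) {N : ℕ}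
    {n : Fin N → ℕ} (hn : Function.Injective n) {M : ℕ} (hM : ∀ i, n i < M) (hNM : N ≤ M) :
    (newtonSumMatrix z c n).det =
      MvPolynomial.C (nodeVandermonde z n) * (flagMatrix N (flagPoly z c n M)).det := by
  have h1 : (baryMatrix z n).map MvPolynomial.C * newtonSumMatrix z c n =
      flagMatrix N (flagPoly z c n M) := by
    ext1 i j
    rw [Matrix.mul_apply, flagMatrix, Matrix.of_apply,
      ← sum_baryWeight_smul_newtonSum hz c hn hM hNM i.rev.isLt, map_sum]
    refine sum_congr rfl fun k _ => ?_
    rw [map_smul, MvPolynomial.smul_eq_C_mul]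
    rfl
  have h2 : ((baryMatrix z n).map MvPolynomial.C : Matrix _ _ (MvPolynomial (Fin N) ℝ)).det =
      MvPolynomial.C (baryMatrix z n).det := by
    rw [RingHom.map_det]; rfl
  rw [← h1, Matrix.det_mul, h2, ← mul_assoc, ← map_mul, mul_comm (nodeVandermonde z n),
    det_baryMatrix_mul hz hn, map_one, one_mul]

/-! ### Normalized multivariate Jacobi polynomials -/

theorem exists_alternant_eq {a b : ℝ} (ha : -1 < a) (hb : -1 < b) (hab : -1 ≤ a + b) {N : ℕ}
    (ν : PosSign N) : ∃ r : ℝ, r ≠ 0 ∧ alternant a b ν =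
      MvPolynomial.C r * (newtonSumMatrix (node (eps a b)) (jacCoeff a) ν.shifted).det := by
  refine ⟨∏ i, (ascPochhammer ℝ (ν.shifted i)).eval (a + 1) / ((ν.shifted i).factorial : ℝ),
    ?_, ?_⟩
  · rw [prod_ne_zero_iff]
    intro i _
    have := ascPochhammer_eval_add_one_pos ha (ν.shifted i)
    positivity
  · rw [alternant, map_prod, ← Matrix.det_mul_column]
    congr 1
    ext1 i j
    simp only [Matrix.of_apply, newtonSumMatrix, jacobiP_eq ha hb hab]
    rw [map_smul, MvPolynomial.smul_eq_C_mul]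

/-- Both sides are multiples of the same quotient, and the flag form gives its value `∏ c_q` at `(1,
…, 1)`. -/
theorem normJacobi_eq_of_flag {a b : ℝ} (ha : -1 < a) (hb : -1 < b) (hab : -1 ≤ a + b) {N : ℕ}
    (ν : PosSign N) {M : ℕ} (hM : ∀ i, ν.shifted i < M) (hNM : N ≤ M) :
    ∃ A : MvPolynomial (Fin N) ℝ, vandermondePoly N * A =
        (flagMatrix N (flagPoly (node (eps a b)) (jacCoeff a) ν.shifted M)).det ∧
      normJacobi a b ν = MvPolynomial.C (∏ q ∈ range N, jacCoeff a q)⁻¹ * A := by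
  have hε : 0 ≤ eps a b := by unfold eps; linarith
  have hz := node_strictMono hε
  have hn := ν.shifted_strictAnti.injective
  obtain ⟨r, hr, halt⟩ := exists_alternant_eq ha hb hab ν
  set z := node (eps a b)
  set c := jacCoeff a
  have hs : r * nodeVandermonde z ν.shifted ≠ 0 := mul_ne_zero hr (nodeVandermonde_ne_zero hz hn)
  set s := r * nodeVandermonde z ν.shifted with hs_def
  have h1 : vandermondePoly N * (MvPolynomial.C s⁻¹ * multiJacobi a b ν) =
      (flagMatrix N (flagPoly z c ν.shifted M)).det := by
    rw [mul_left_comm, vandermondePoly_mul_multiJacobi, halt, det_newtonSumMatrix hz c hn hM hNM,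
      ← mul_assoc (MvPolynomial.C r), ← map_mul, ← mul_assoc, ← map_mul, ← hs_def,
      inv_mul_cancel₀ hs, map_one, one_mul]
  refine ⟨_, h1, ?_⟩
  have h2 := eval_one_eq_of_vandermondePoly_mul _ _ h1
  rw [prod_congr rfl fun q hq => flagPoly_eval_one hz c hn hNM (mem_range.1 hq), map_mul,
    MvPolynomial.eval_C] at h2
  rw [normJacobi, ← mul_assoc, ← map_mul]
  congr 2
  rw [← h2, mul_inv, inv_inv, mul_right_comm, mul_inv_cancel₀ hs, one_mul]

theorem vandermondePoly_mul_normJacobi {a b : ℝ} (ha : -1 < a) (hb : -1 < b) (hab : -1 ≤ a + b)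
    {N : ℕ} (ν : PosSign N) : vandermondePoly N * normJacobi a b ν =
      MvPolynomial.C (nodeVandermonde (node (eps a b)) ν.shifted *
        ∏ q ∈ range N, jacCoeff a q)⁻¹ *
        (newtonSumMatrix (node (eps a b)) (jacCoeff a) ν.shifted).det := by
  have hε : 0 ≤ eps a b := by unfold eps; linarith
  have hz := node_strictMono hε
  have hn := ν.shifted_strictAnti.injective
  -- Any bound exceeding all `n_i` and at least `N` serves, since Newton polynomials of index above
  -- `n_i` vanish at `z_{n_i}`.
  have hM : ∀ i, ν.shifted i < univ.sup ν.shifted + 1 + N := fun i => by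
    have := le_sup (f := ν.shifted) (mem_univ i)
    omega
  obtain ⟨A, hA, h⟩ := normJacobi_eq_of_flag ha hb hab ν hM (by omega)
  rw [h, mul_left_comm, hA, det_newtonSumMatrix hz _ hn hM (by omega), ← mul_assoc, ← map_mul,
    mul_inv, mul_right_comm, inv_mul_cancel₀ (nodeVandermonde_ne_zero hz hn), one_mul]

theorem vandermondePoly_mul_restrictHom_normJacobi {a b : ℝ} (ha : -1 < a) (hb : -1 < b)
    (hab : -1 ≤ a + b) {K d : ℕ} (ν : PosSign (K + d)) {M : ℕ} (hM : ∀ i, ν.shifted i < M)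
    (hNM : K + d ≤ M) :
    vandermondePoly K * restrictHom (K + d) K (normJacobi a b ν) =
      MvPolynomial.C (∏ q ∈ range K, jacCoeff a (q + d))⁻¹ *
        (flagMatrix K fun q =>
          flagPoly (node (eps a b)) (jacCoeff a) ν.shifted M (q + d)).det := by
  have hε : 0 ≤ eps a b := by unfold eps; linarith
  have hz := node_strictMono hε
  have hn := ν.shifted_strictAnti.injective
  obtain ⟨A, hA, h⟩ := normJacobi_eq_of_flag ha hb hab ν hM hNM
  have h1 := vandermondePoly_mul_restrictHom d _ A hA
  rw [prod_congr rfl fun q hq => flagPoly_eval_one hz _ hn hNM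
    (by have := mem_range.1 hq; omega)] at h1
  rw [h, map_mul, ← MvPolynomial.algebraMap_eq, AlgHom.commutes, MvPolynomial.algebraMap_eq,
    mul_left_comm, h1, ← mul_assoc, ← map_mul]
  congr 2
  have h2 : ∏ q ∈ range (K + d), jacCoeff a q =
      (∏ q ∈ range d, jacCoeff a q) * ∏ q ∈ range K, jacCoeff a (q + d) := by
    rw [add_comm K d, prod_range_add]
    simp only [add_comm d]
  have h3 : ∏ q ∈ range d, jacCoeff a q ≠ 0 :=
    prod_ne_zero_iff.2 fun q _ => (jacCoeff_pos ha q).ne'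
  rw [h2, mul_inv, mul_right_comm, inv_mul_cancel₀ h3, one_mul]

/-! ### Expansions in inverse Newton products -/

/-- The truncated Newton expansion of `1 / (u - s)`, a telescoping sum. The remainder vanishes when
`s` is one of the first `M` nodes. -/
theorem sum_newton_div_prod {F : Type*} [Field F] (ι : ℝ →+* F) (u : F) (hu : ∀ r, u - ι r ≠ 0)
    (z : ℕ → ℝ) (s : ℝ) (M : ℕ) :
    ∑ m ∈ range M, ι ((newton z m).eval s) / ∏ j ∈ range (m + 1), (u - ι (z j)) =
      (1 - ι ((newton z M).eval s) / ∏ j ∈ range M, (u - ι (z j))) / (u - ι s) := by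
  induction M with
  | zero => simp [newton]
  | succ M ih =>
    have h1 : ∏ j ∈ range M, (u - ι (z j)) ≠ 0 := prod_ne_zero_iff.2 fun j _ => hu _
    have h2 := hu s
    have h3 := hu (z M)
    rw [sum_range_succ, ih, eval_newton_succ, prod_range_succ, map_mul, map_sub]
    field_simp
    ring

/-- Summing the kernel expansion against the weights gives `∑_i w_i φ_q(z_{n_i}) / (u - z_{n_i})`.
As `deg φ_q < N`, this is the partial fraction form of the right side. -/
theorem sum_pairing_div_prod {F : Type*} [Field F] (ι : ℝ →+* F) (u : F)
    (hu : ∀ r, u - ι r ≠ 0) {z : ℕ → ℝ} (hz : StrictMono z) {N : ℕ} {n : Fin N → ℕ}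
    (hn : Function.Injective n) {M : ℕ} (hM : ∀ i, n i < M) {q : ℕ} (hq : q < N) :
    ∑ m ∈ range M, ι (pairing z n (tailPoly z N q) (newton z m)) /
        ∏ j ∈ range (m + 1), (u - ι (z j)) =
      (∏ j ∈ Ico (q + 1) N, (u - ι (z j))) / ∏ i, (u - ι (z (n i))) := by
  have h1 : ∑ m ∈ range M, ι (pairing z n (tailPoly z N q) (newton z m)) /
        ∏ j ∈ range (m + 1), (u - ι (z j)) =
      ∑ i, ι (baryWeight z n i) * (u - ι (z (n i)))⁻¹ *
        ι ((tailPoly z N q).eval (z (n i))) := by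
    have : ∀ i, ι (baryWeight z n i) * (u - ι (z (n i)))⁻¹ * ι ((tailPoly z N q).eval (z (n i))) =
        ∑ m ∈ range M, ι (baryWeight z n i) * ι ((tailPoly z N q).eval (z (n i))) *
          (ι ((newton z m).eval (z (n i))) / ∏ j ∈ range (m + 1), (u - ι (z j))) := by
      intro i
      rw [← mul_sum, sum_newton_div_prod ι u hu, eval_newton_eq_zero z (hM i)]
      simp only [map_zero, zero_div, sub_zero, one_div]
      ring
    rw [sum_congr rfl fun i _ => this i, sum_comm]
    refine sum_congr rfl fun m _ => ?_
    rw [pairing, map_sum, sum_div]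
    refine sum_congr rfl fun i _ => ?_
    rw [map_mul, map_mul]
    ring
  have hv : Set.InjOn (fun i => ι (z (n i))) (univ : Finset (Fin N)) :=
    (ι.injective.comp (hz.injective.comp hn)).injOn
  have h2 := Lagrange.eq_interpolate (f := (tailPoly z N q).map ι) hv (by
    rw [Polynomial.degree_map, Polynomial.degree_eq_natDegree (tailPoly_monic z N q).ne_zero,
      natDegree_tailPoly, card_univ, Fintype.card_fin]
    exact_mod_cast (by omega : N - (q + 1) < N))
  have h3 := congrArg (Polynomial.eval u) h2
  rw [Lagrange.eval_interpolate_not_at_node _ fun i _ => sub_ne_zero.1 (hu _),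
    Lagrange.eval_nodal] at h3
  rw [h1, eq_div_iff (prod_ne_zero_iff.2 fun i _ => hu _), mul_comm]
  have h4 : Polynomial.eval u ((tailPoly z N q).map ι) = ∏ j ∈ Ico (q + 1) N, (u - ι (z j)) := by
    simp [tailPoly, Polynomial.map_prod, Polynomial.eval_prod]
  rw [← h4, h3]
  congr 1
  refine sum_congr rfl fun i _ => ?_
  rw [Polynomial.eval_map_apply]
  congr 2
  simp [baryWeight, Lagrange.nodalWeight, map_prod]

/-! ### The isomorphism of polynomials with even rational functions -/

/-- `const` as a ring homomorphism. -/
def constHom : ℝ →+* RatFunc ℂ := (RatFunc.C : ℂ →+* RatFunc ℂ).comp Complex.ofRealHom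

theorem constHom_apply (r : ℝ) : constHom r = const r := rfl

theorem degree_X_sub_one_pow (m : ℕ) : ((Polynomial.X - 1 : Polynomial ℂ) ^ m).degree = m := by
  rw [← Polynomial.C_1, Polynomial.degree_pow, Polynomial.degree_X_sub_C]
  simp

/-- The basis `(x - 1)^m` of the polynomials. -/
def powBasis : Module.Basis ℕ ℂ (Polynomial ℂ) :=
  Polynomial.Sequence.basis ⟨fun m => (Polynomial.X - 1) ^ m, degree_X_sub_one_pow⟩ fun i =>
    isUnit_iff_ne_zero.2 (Polynomial.leadingCoeff_ne_zero.2 (Polynomial.Sequence.ne_zero _ i))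

theorem powBasis_apply (m : ℕ) : powBasis m = (Polynomial.X - 1) ^ m :=
  Polynomial.Sequence.basis_eq_self _ _ m

/-- The functions `1 / ∏_{j<m} (t² - (L + j + ε)²)` as a basis of the space of even functions. -/
def elemBasis {ε : ℝ} (hε : 0 ≤ ε) {L : ℕ} (hL : 1 ≤ L) : Module.Basis ℕ ℂ (evenSpace ε L) :=
  Module.Basis.mk (v := fun m => (⟨elemFun ε L m, elemFun_mem hε hL m⟩ : evenSpace ε L))
    (LinearIndependent.of_comp (evenSpace ε L).subtype (linearIndependent_elemFun ε L))
    (by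
      rintro ⟨f, hf⟩ -
      have h := mem_span_elemFun hf
      rw [← Submodule.comap_map_eq_of_injective (evenSpace ε L).injective_subtype
        (Submodule.span ℂ _), Submodule.mem_comap, Submodule.map_span, ← Set.range_comp]
      exact h)

theorem elemBasis_apply {ε : ℝ} (hε : 0 ≤ ε) {L : ℕ} (hL : 1 ≤ L) (m : ℕ) :
    (elemBasis hε hL m : RatFunc ℂ) = elemFun ε L m := by
  simp [elemBasis]

/-- The isomorphism `(x - 1)^m ↦ (c_{L-1} / c_{L-1+m}) / ∏_{j<m} (t² - (L + j + ε)²)`,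
where `L = d + 1`. -/
def evenEquiv {ε : ℝ} (hε : 0 ≤ ε) {c : ℕ → ℝ} (hc : ∀ m, c m ≠ 0) (d : ℕ) :
    Polynomial ℂ ≃ₗ[ℂ] evenSpace ε (d + 1) :=
  powBasis.equiv ((elemBasis hε (Nat.succ_le_succ d.zero_le)).unitsSMul fun m =>
    Units.mk0 ((c d / c (d + m) : ℝ) : ℂ)
      (by exact_mod_cast div_ne_zero (hc d) (hc (d + m)))) (Equiv.refl ℕ)

theorem evenEquiv_pow {ε : ℝ} (hε : 0 ≤ ε) {c : ℕ → ℝ} (hc : ∀ m, c m ≠ 0) (d m : ℕ) :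
    (evenEquiv hε hc d ((Polynomial.X - 1) ^ m) : RatFunc ℂ) =
      const (c d / c (d + m)) * elemFun ε (d + 1) m := by
  rw [← powBasis_apply, evenEquiv, Module.Basis.equiv_apply, Module.Basis.unitsSMul_apply]
  simp only [Equiv.refl_apply, Units.smul_def, Units.val_mk0, Submodule.coe_smul, elemBasis_apply]
  rw [RatFunc.smul_eq_C_mul]
  rfl

/-- The isomorphism `evenEquiv` on polynomials with real coefficients. -/
def realTrans {ε : ℝ} (hε : 0 ≤ ε) {c : ℕ → ℝ} (hc : ∀ m, c m ≠ 0) (d : ℕ) :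
    Polynomial ℝ →+ RatFunc ℂ :=
  ((evenSpace ε (d + 1)).subtype.comp (evenEquiv hε hc d).toLinearMap).toAddMonoidHom.comp
    (Polynomial.mapRingHom Complex.ofRealHom).toAddMonoidHom

theorem realTrans_apply {ε : ℝ} (hε : 0 ≤ ε) {c : ℕ → ℝ} (hc : ∀ m, c m ≠ 0) (d : ℕ)
    (p : Polynomial ℝ) :
    realTrans hε hc d p = evenEquiv hε hc d (p.map Complex.ofRealHom) := rfl

theorem realTrans_smul {ε : ℝ} (hε : 0 ≤ ε) {c : ℕ → ℝ} (hc : ∀ m, c m ≠ 0) (d : ℕ) (r : ℝ)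
    (p : Polynomial ℝ) : realTrans hε hc d (r • p) = const r * realTrans hε hc d p := by
  rw [realTrans_apply, realTrans_apply, Polynomial.smul_eq_C_mul, Polynomial.map_mul,
    Polynomial.map_C, ← Polynomial.smul_eq_C_mul, map_smul, Submodule.coe_smul,
    RatFunc.smul_eq_C_mul]
  rfl

theorem realTrans_pow {ε : ℝ} (hε : 0 ≤ ε) {c : ℕ → ℝ} (hc : ∀ m, c m ≠ 0) (d m : ℕ) :
    realTrans hε hc d ((Polynomial.X - 1) ^ m) =
      const (c d / c (d + m)) * elemFun ε (d + 1) m := by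
  rw [realTrans_apply, ← evenEquiv_pow hε hc]
  simp

theorem realTrans_newtonSum {ε : ℝ} (hε : 0 ≤ ε) {c : ℕ → ℝ} (hc : ∀ m, c m ≠ 0) (d : ℕ)
    (z : ℕ → ℝ) (k : ℕ) : realTrans hε hc d (newtonSum z c k) =
      ∑ m ∈ range (k + 1), const (c m * (newton z m).eval (z k) * (c d / c (d + m))) *
        elemFun ε (d + 1) m := by
  rw [newtonSum, map_sum]
  refine sum_congr rfl fun m _ => ?_
  rw [realTrans_smul, realTrans_pow, ← mul_assoc, ← constHom_apply, ← constHom_apply, ← map_mul,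
    constHom_apply]

/-! ### The functions `g_k` -/

theorem poch_eq_prod {F : Type*} [Field F] (x : F) (m : ℕ) :
    poch x m = ∏ j ∈ range m, (x + j) := by
  induction m with
  | zero => simp [poch]
  | succ m ih => rw [poch, ascPochhammer_succ_eval, prod_range_succ, ← ih, poch]

theorem poch_const (r : ℝ) (m : ℕ) : poch (const r) m = const (∏ j ∈ range m, (r + j)) := by
  rw [poch_eq_prod, ← constHom_apply, ← constHom_apply, map_prod]
  simp

theorem jacCoeff_div {a : ℝ} (ha : -1 < a) (d m : ℕ) : jacCoeff a d / jacCoeff a (d + m) =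
    2 ^ m * ((∏ j ∈ range m, (((d + 1 : ℕ) : ℝ) + j)) *
      ∏ j ∈ range m, ((((d + 1 : ℕ) : ℝ) + a) + j)) := by
  induction m with
  | zero => simp [(jacCoeff_pos ha d).ne']
  | succ m ih =>
    have h0 := (jacCoeff_pos ha (d + m + 1)).ne'
    have h1 := jacCoeff_succ ha (d + m)
    rw [div_eq_iff (jacCoeff_pos ha (d + m)).ne'] at ih
    rw [div_eq_iff (jacCoeff_pos ha (d + (m + 1))).ne', ih, ← add_assoc, ← h1, prod_range_succ,
      prod_range_succ, pow_succ]
    push_cast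
    ring

/-- A termwise match. Since `(j - k)(k + 2ε + j) = z_j - z_k`, the first two Pochhammer symbols give
a Newton product up to `(-1)^m`; the two containing `t` give `1 / elemFun` up to the same sign. The
others form `c_d / c_{d+m}` and `c_m`, and the powers of two cancel. -/
theorem gFun_eq_realTrans {a ε : ℝ} (ha : -1 < a) (hε : 0 ≤ ε) (d k : ℕ) :
    gFun a ε (d + 1) k = realTrans hε (fun m => (jacCoeff_pos ha m).ne') d
      (newtonSum (node ε) (jacCoeff a) k) := by
  rw [realTrans_newtonSum, gFun, hyp43]
  refine sum_congr rfl fun m _ => ?_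
  have h1 : poch (const (-k)) m * poch (const (k + 2 * ε)) m =
      const ((-1) ^ m * (newton (node ε) m).eval (node ε k)) := by
    rw [poch_const, poch_const, ← constHom_apply, ← constHom_apply, ← map_mul, constHom_apply,
      ← prod_mul_distrib, eval_newton]
    have : (-1 : ℝ) ^ m = ∏ j ∈ range m, (-1 : ℝ) := by rw [prod_const, card_range]
    rw [this, ← prod_mul_distrib]
    congr 1
    refine prod_congr rfl fun j _ => ?_
    simp only [node]
    ring
  have h2 : poch (const ((d + 1 : ℕ) : ℝ)) m * poch (const (((d + 1 : ℕ) : ℝ) + a)) m =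
      const (jacCoeff a d / jacCoeff a (d + m) / 2 ^ m) := by
    rw [poch_const, poch_const, ← constHom_apply, ← constHom_apply, ← map_mul, constHom_apply,
      jacCoeff_div ha, mul_div_cancel_left₀ _ (by positivity)]
  have h3 : poch (-RatFunc.X + const (((d + 1 : ℕ) : ℝ) + ε)) m *
      poch (RatFunc.X + const (((d + 1 : ℕ) : ℝ) + ε)) m =
      const ((-1) ^ m) * (elemFun ε (d + 1) m)⁻¹ := by
    have : const ((-1) ^ m) = ∏ j ∈ range m, (-1 : RatFunc ℂ) := by
      rw [prod_const, card_range, ← constHom_apply]; simp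
    rw [poch_eq_prod, poch_eq_prod, ← prod_mul_distrib, this, elemFun, ← prod_inv_distrib,
      ← prod_mul_distrib]
    refine prod_congr rfl fun j _ => ?_
    rw [inv_inv, node, ← constHom_apply, ← constHom_apply]
    simp only [map_pow, map_add, map_natCast, Nat.cast_add, Nat.cast_one, map_one]
    ring
  have h4 : poch (const (a + 1)) m * (m.factorial : RatFunc ℂ) =
      const ((jacCoeff a m * 2 ^ m)⁻¹) := by
    have hf : (m.factorial : RatFunc ℂ) = const (m.factorial : ℝ) := by
      rw [← constHom_apply]; simp
    rw [poch_const, hf, ← constHom_apply, ← constHom_apply, ← map_mul, constHom_apply]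
    congr 1
    rw [← poch_eq_prod, poch, jacCoeff]
    have := (ascPochhammer_eval_add_one_pos ha m).ne'
    field_simp
  have e1 : poch (const (-k)) m * poch (const (k + 2 * ε)) m * poch (const ((d + 1 : ℕ) : ℝ)) m *
      poch (const (((d + 1 : ℕ) : ℝ) + a)) m = const ((-1) ^ m *
        (newton (node ε) m).eval (node ε k)) *
        const (jacCoeff a d / jacCoeff a (d + m) / 2 ^ m) := by
    rw [← h1, ← h2]; ring
  have e2 : poch (-RatFunc.X + const (((d + 1 : ℕ) : ℝ) + ε)) m *
      poch (RatFunc.X + const (((d + 1 : ℕ) : ℝ) + ε)) m * poch (const (a + 1)) m *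
      (m.factorial : RatFunc ℂ) = const ((-1) ^ m) * (elemFun ε (d + 1) m)⁻¹ *
        const ((jacCoeff a m * 2 ^ m)⁻¹) := by
    rw [← h3, ← h4]; ring
  rw [e1, e2]
  have hE := elemFun_ne_zero ε (d + 1) m
  have hc0 : constHom (jacCoeff a m) ≠ 0 := (map_ne_zero _).2 (jacCoeff_pos ha m).ne'
  have hc1 : constHom (jacCoeff a (d + m)) ≠ 0 := (map_ne_zero _).2 (jacCoeff_pos ha _).ne'
  simp only [← constHom_apply, map_mul, map_inv₀, map_div₀, map_pow, map_neg, map_one, map_ofNat]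
  field_simp

/-! ### Multiplication by the characteristic function -/

/-- In `F_N = ∏_{j<N} (u - z_j) / ∏_i (u - z_{n_i})` with `u = t²`, the elementary function cancels
the factors `d < j ≤ d + k`; those beyond form `φ_{d+k}`. -/
theorem elemFun_mul_charFun {ε : ℝ} {N d k : ℕ} (hk : d + k < N) (ν : PosSign N) :
    elemFun ε (d + 1) k * charFun ε ν = (∏ j ∈ range (d + 1), (RatFunc.X ^ 2 - const (node ε j))) *
      ((∏ j ∈ Ico (d + k + 1) N, (RatFunc.X ^ 2 - const (node ε j))) /
        ∏ i, (RatFunc.X ^ 2 - const (node ε (ν.shifted i)))) := by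
  have h1 : charFun ε ν = (∏ j ∈ range N, (RatFunc.X ^ 2 - const (node ε j))) /
      ∏ i, (RatFunc.X ^ 2 - const (node ε (ν.shifted i))) := by
    rw [charFun, prod_div_distrib, ← Fin.prod_univ_eq_prod_range
      (fun j => (RatFunc.X ^ 2 - const (node ε j) : RatFunc ℂ)), ← Equiv.prod_comp Fin.revPerm
        (fun i : Fin N => (RatFunc.X ^ 2 - const (node ε (i : ℕ)) : RatFunc ℂ))]
    rfl
  have h2 : ∏ j ∈ range N, (RatFunc.X ^ 2 - const (node ε j)) =
      (∏ j ∈ range (d + 1), (RatFunc.X ^ 2 - const (node ε j))) * (elemFun ε (d + 1) k)⁻¹ *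
      ∏ j ∈ Ico (d + k + 1) N, (RatFunc.X ^ 2 - const (node ε j)) := by
    rw [← prod_range_mul_prod_Ico _ (show d + k + 1 ≤ N by omega),
      show d + k + 1 = d + 1 + k by omega, prod_range_add, elemFun, ← prod_inv_distrib]
    simp only [inv_inv]
  have hE := elemFun_ne_zero ε (d + 1) k
  rw [h1, h2]
  field_simp

theorem elemFun_eq_div {ε : ℝ} {d m : ℕ} (hm : d ≤ m) : elemFun ε (d + 1) (m - d) =
    (∏ j ∈ range (d + 1), (RatFunc.X ^ 2 - const (node ε j))) /
      ∏ j ∈ range (m + 1), (RatFunc.X ^ 2 - const (node ε j)) := by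
  have h0 : ∏ j ∈ range (d + 1), (RatFunc.X ^ 2 - const (node ε j)) ≠ 0 :=
    prod_ne_zero_iff.2 fun j _ => X_sq_sub_const_ne_zero _
  rw [show m + 1 = d + 1 + (m - d) by omega, prod_range_add _ (d + 1) (m - d), elemFun,
    prod_inv_distrib, ← div_div, div_self h0, one_div]

/-- The scaling in `evenEquiv` replaces the `c_m` in the flag polynomial by `c_d`; what remains is
`sum_pairing_div_prod` times `∏_{j≤d} (u - z_j)`. -/
theorem realTrans_pow_mul_flagPoly {ε : ℝ} (hε : 0 ≤ ε) {c : ℕ → ℝ} (hc : ∀ m, c m ≠ 0)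
    {N d k : ℕ} (hk : d + k < N) (ν : PosSign N) {M : ℕ} (hM : ∀ i, ν.shifted i < M)
    (hNM : N ≤ M) :
    realTrans hε hc d ((Polynomial.X - 1) ^ k * flagPoly (node ε) c ν.shifted M (k + d)) =
      const (c d) * (elemFun ε (d + 1) k * charFun ε ν) := by
  have hz := node_strictMono hε
  have hn := ν.shifted_strictAnti.injective
  rw [elemFun_mul_charFun hk]
  have h1 := sum_pairing_div_prod constHom (RatFunc.X ^ 2) (fun r => X_sq_sub_const_ne_zero r) hz
    hn hM hk
  simp only [constHom_apply] at h1
  rw [← h1, flagPoly, mul_sum, map_sum, mul_sum, mul_sum, add_comm k d,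
    ← sum_range_add_sum_Ico _ (show d + k ≤ M by omega), sum_eq_zero (s := range (d + k)),
    zero_add]
  · refine sum_congr rfl fun m hm => ?_
    have hm := mem_Ico.1 hm
    rw [mul_smul_comm, ← pow_add, show k + (m - (d + k)) = m - d by omega, realTrans_smul,
      realTrans_pow, elemFun_eq_div (by omega), show d + (m - d) = m by omega]
    have hc1 : constHom (c m) ≠ 0 := (map_ne_zero _).2 (hc m)
    simp only [← constHom_apply, map_mul, map_div₀]
    field_simp
  · intro m hm
    rw [pairing_tailPoly_newton_of_lt hz hn hk (mem_range.1 hm), ← constHom_apply 0, map_zero]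
    simp

/-- The polynomial corresponding to `g_k F_N`. -/
def mulPoly (z c : ℕ → ℝ) {N : ℕ} (n : Fin N → ℕ) (M d k : ℕ) : Polynomial ℝ :=
  ∑ m ∈ range (k + 1), (c m * (newton z m).eval (z k) / c (d + m)) •
    ((Polynomial.X - 1) ^ m * flagPoly z c n M (m + d))

theorem gFun_mul_charFun {a ε : ℝ} (ha : -1 < a) (hε : 0 ≤ ε) {N d k : ℕ} (hk : d + k < N)
    (ν : PosSign N) {M : ℕ} (hM : ∀ i, ν.shifted i < M) (hNM : N ≤ M) :
    gFun a ε (d + 1) k * charFun ε ν = realTrans hε (fun m => (jacCoeff_pos ha m).ne') d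
      (mulPoly (node ε) (jacCoeff a) ν.shifted M d k) := by
  rw [gFun_eq_realTrans ha hε, realTrans_newtonSum, mulPoly, map_sum, sum_mul]
  refine sum_congr rfl fun m hm => ?_
  have hm := mem_range.1 hm
  rw [realTrans_smul, realTrans_pow_mul_flagPoly hε _ (by omega) ν hM hNM]
  simp only [← constHom_apply, map_mul, map_div₀]
  ring

/-! ### Linear independence of the multivariate Jacobi polynomials -/

/-- The product of linear functionals applied in the separate variables. -/
def prodFunctional {K : ℕ} (l : Fin K → Polynomial ℝ →ₗ[ℝ] ℝ) :
    MvPolynomial (Fin K) ℝ →ₗ[ℝ] ℝ :=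
  (MvPolynomial.basisMonomials (Fin K) ℝ).constr ℝ fun α => ∏ j, l j (Polynomial.X ^ α j)

theorem prodFunctional_prod {K : ℕ} (l : Fin K → Polynomial ℝ →ₗ[ℝ] ℝ)
    (p : Fin K → Polynomial ℝ) :
    prodFunctional l (∏ j, Polynomial.aeval (MvPolynomial.X j : MvPolynomial (Fin K) ℝ) (p j)) =
      ∏ j, l j (p j) := by
  have h : (prodFunctional l).compMultilinearMap
      ((MultilinearMap.mkPiAlgebra ℝ (Fin K) (MvPolynomial (Fin K) ℝ)).compLinearMap fun j =>
        (Polynomial.aeval (MvPolynomial.X j : MvPolynomial (Fin K) ℝ)).toLinearMap) =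
      (MultilinearMap.mkPiAlgebra ℝ (Fin K) ℝ).compLinearMap l := by
    refine Module.Basis.ext_multilinear (fun _ => Polynomial.basisMonomials ℝ) fun v => ?_
    have h1 : ∏ j, (MvPolynomial.X j : MvPolynomial (Fin K) ℝ) ^ v j =
        MvPolynomial.basisMonomials (Fin K) ℝ (Finsupp.equivFunOnFinite.symm v) := by
      rw [MvPolynomial.coe_basisMonomials]
      refine Eq.trans ?_ MvPolynomial.prod_X_pow_eq_monomial
      symm
      refine prod_subset (subset_univ _) fun j _ hj => ?_
      rw [Finsupp.notMem_support_iff.1 hj, pow_zero]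
    simp only [LinearMap.compMultilinearMap_apply, MultilinearMap.compLinearMap_apply,
      MultilinearMap.mkPiAlgebra_apply, AlgHom.toLinearMap_apply, Polynomial.coe_basisMonomials,
      Polynomial.aeval_monomial, map_one, one_mul]
    rw [h1, prodFunctional, Module.Basis.constr_basis]
    simp [Polynomial.X_pow_eq_monomial]
  exact DFunLike.congr_fun h p

theorem degree_newtonSum {z c : ℕ → ℝ} (hz : StrictMono z) (hc : ∀ m, c m ≠ 0) (n : ℕ) :
    (newtonSum z c n).degree = n := by
  rw [Polynomial.degree_eq_natDegree, natDegree_newtonSum hz hc]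
  intro h0
  have := coeff_newtonSum_self z c n
  rw [h0, Polynomial.coeff_zero] at this
  exact mul_ne_zero (hc n) (eval_newton_self_ne_zero hz n) this.symm

/-- The polynomials `newtonSum z c n` as a basis of the real polynomials. -/
def newtonBasis {z c : ℕ → ℝ} (hz : StrictMono z) (hc : ∀ m, c m ≠ 0) :
    Module.Basis ℕ ℝ (Polynomial ℝ) :=
  Polynomial.Sequence.basis ⟨newtonSum z c, degree_newtonSum hz hc⟩ fun i =>
    isUnit_iff_ne_zero.2 (Polynomial.leadingCoeff_ne_zero.2 (Polynomial.Sequence.ne_zero _ i))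

theorem newtonBasis_apply {z c : ℕ → ℝ} (hz : StrictMono z) (hc : ∀ m, c m ≠ 0) (n : ℕ) :
    newtonBasis hz hc n = newtonSum z c n :=
  Polynomial.Sequence.basis_eq_self _ _ n

/-- Coordinate functionals in separate variables act as a dual basis on alternants: a permutation
contributes only if it carries one decreasing tuple to the other. -/
theorem prodFunctional_det {z c : ℕ → ℝ} (hz : StrictMono z) (hc : ∀ m, c m ≠ 0) {K : ℕ}
    (κ μ : PosSign K) :
    prodFunctional (fun j => (newtonBasis hz hc).coord (μ.shifted j))
      (newtonSumMatrix z c κ.shifted).det = if κ = μ then 1 else 0 := by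
  classical
  have h1 : prodFunctional (fun j => (newtonBasis hz hc).coord (μ.shifted j))
      (newtonSumMatrix z c κ.shifted).det =
      (Matrix.of fun i j : Fin K => if κ.shifted i = μ.shifted j then (1 : ℝ) else 0).det := by
    rw [Matrix.det_apply, Matrix.det_apply, map_sum]
    refine sum_congr rfl fun σ _ => ?_
    rw [Units.smul_def, Units.smul_def, map_zsmul]
    congr 1
    simp only [newtonSumMatrix, Matrix.of_apply]
    rw [prodFunctional_prod]
    refine prod_congr rfl fun j _ => ?_
    rw [← newtonBasis_apply hz hc, Module.Basis.coord_apply, Module.Basis.repr_self,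
      Finsupp.single_apply]
  rw [h1]
  split_ifs with h
  · subst h
    have : (Matrix.of fun i j : Fin K => if κ.shifted i = κ.shifted j then (1 : ℝ) else 0) = 1 := by
      ext i j
      simp [Matrix.one_apply, κ.shifted_strictAnti.injective.eq_iff]
    rw [this, Matrix.det_one]
  · rw [Matrix.det_apply]
    refine sum_eq_zero fun σ _ => ?_
    obtain ⟨j, hj⟩ : ∃ j, κ.shifted (σ j) ≠ μ.shifted j := by
      by_contra hcon
      push Not at hcon
      exact h (PosSign.eq_of_shifted_comp_perm (σ := σ) (τ := 1) (funext hcon))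
    rw [prod_eq_zero (mem_univ j) (by simp [hj]), smul_zero]

theorem linearIndependent_normJacobi {a b : ℝ} (ha : -1 < a) (hb : -1 < b) (hab : -1 ≤ a + b)
    (K : ℕ) : LinearIndependent ℝ (normJacobi a b : PosSign K → MvPolynomial (Fin K) ℝ) := by
  classical
  have hε : 0 ≤ eps a b := by unfold eps; linarith
  have hz := node_strictMono hε
  have hc : ∀ m, jacCoeff a m ≠ 0 := fun m => (jacCoeff_pos ha m).ne'
  rw [linearIndependent_iff']
  intro s g hg μ hμ
  have h1 := congrArg (fun x => prodFunctional
    (fun j => (newtonBasis hz hc).coord (μ.shifted j)) (vandermondePoly K * x)) hg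
  simp only [mul_sum, mul_smul_comm, map_sum, map_smul, mul_zero, map_zero,
    vandermondePoly_mul_normJacobi ha hb hab, ← MvPolynomial.smul_eq_C_mul,
    prodFunctional_det hz hc] at h1
  rw [sum_eq_single μ] at h1
  · simp only [if_true, smul_eq_mul, mul_one, mul_eq_zero] at h1
    refine h1.resolve_right (inv_ne_zero (mul_ne_zero ?_ ?_))
    · exact nodeVandermonde_ne_zero hz μ.shifted_strictAnti.injective
    · exact prod_ne_zero_iff.2 fun q _ => hc q
  · intro κ _ hκ
    simp [hκ]
  · intro h; exact absurd hμ h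

theorem isExpansion_unique {a b : ℝ} (ha : -1 < a) (hb : -1 < b) (hab : -1 ≤ a + b) {N K : ℕ}
    {ν : PosSign N} {c c' : PosSign K →₀ ℝ} (h : IsExpansion a b ν c)
    (h' : IsExpansion a b ν c') : c = c' := by
  apply linearIndependent_normJacobi ha hb hab K
  simp only [IsExpansion, ← MvPolynomial.smul_eq_C_mul] at h h'
  rw [Finsupp.linearCombination_apply, Finsupp.linearCombination_apply, ← h, ← h']

/-! ### The determinantal formula -/

/-- Newton polynomials evaluated at their own nodes form a triangular matrix. This computes the
denominator of `d_K`. -/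
theorem nodeVandermonde_rev (z : ℕ → ℝ) (K : ℕ) :
    nodeVandermonde z (fun i : Fin K => (i.rev : ℕ)) =
      ∏ k ∈ range K, (newton z k).eval (z k) := by
  rw [nodeVandermonde, ← det_eval_monic_rev (fun i : Fin K => z i.rev) (newton z)
    (natDegree_newton z) (newton_monic z), Matrix.det_of_isUpperTriangular]
  · rw [← Fin.prod_univ_eq_prod_range (fun k => (newton z k).eval (z k))]
    exact Equiv.prod_comp Fin.revPerm (fun i : Fin K => (newton z i).eval (z i))
  · intro i j hij
    exact eval_newton_eq_zero z (Fin.rev_lt_rev.2 hij)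

theorem dFactor_eq (ε : ℝ) {K : ℕ} (κ : PosSign K) : dFactor ε κ =
    nodeVandermonde (node ε) κ.shifted / ∏ k ∈ range K, (newton (node ε) k).eval (node ε k) := by
  rw [← nodeVandermonde_rev, nodeVandermonde, nodeVandermonde, ← prod_div_distrib]
  rfl

/-- The `mulPoly`s arise from the flag polynomials by a triangular matrix, as the Newton polynomial
of index `m > k` vanishes at `z_k`. -/
theorem det_mulPoly (z : ℕ → ℝ) (c : ℕ → ℝ) {N : ℕ} (n : Fin N → ℕ) (M d K : ℕ) :
    (Matrix.of fun j l : Fin K => Polynomial.aeval (MvPolynomial.X l : MvPolynomial (Fin K) ℝ)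
      (mulPoly z c n M d j.rev)).det =
      MvPolynomial.C (∏ k ∈ range K, c k * (newton z k).eval (z k) / c (d + k)) *
        (flagMatrix K fun q => flagPoly z c n M (q + d)).det := by
  let T : Matrix (Fin K) (Fin K) ℝ := Matrix.of fun j i =>
    c i.rev * (newton z i.rev).eval (z j.rev) / c (d + i.rev)
  have h1 : (Matrix.of fun j l : Fin K =>
      Polynomial.aeval (MvPolynomial.X l : MvPolynomial (Fin K) ℝ) (mulPoly z c n M d j.rev)) =
      T.map MvPolynomial.C * flagMatrix K fun q => flagPoly z c n M (q + d) := by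
    ext1 j l
    have h2 : mulPoly z c n M d j.rev = ∑ i : Fin K, T j i •
        ((Polynomial.X - 1) ^ (i.rev : ℕ) * flagPoly z c n M (i.rev + d)) := by
      refine Eq.trans ?_ (Equiv.sum_comp Fin.revPerm (fun i : Fin K =>
        (c i * (newton z i).eval (z j.rev) / c (d + i)) •
        ((Polynomial.X - 1) ^ (i : ℕ) * flagPoly z c n M (i + d)))).symm
      rw [Fin.sum_univ_eq_sum_range (fun i =>
        (c i * (newton z i).eval (z j.rev) / c (d + i)) •
        ((Polynomial.X - 1) ^ i * flagPoly z c n M (i + d))), mulPoly]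
      refine sum_subset (fun m hm => ?_) fun m _ hm => ?_
      · have := j.rev.isLt
        simp only [mem_range] at hm ⊢; omega
      · rw [eval_newton_eq_zero z (by simpa using hm), mul_zero, zero_div, zero_smul]
    rw [Matrix.mul_apply, Matrix.of_apply, h2, map_sum]
    refine sum_congr rfl fun i _ => ?_
    rw [map_smul, MvPolynomial.smul_eq_C_mul]
    rfl
  have h3 : (T.map MvPolynomial.C : Matrix _ _ (MvPolynomial (Fin K) ℝ)).det =
      MvPolynomial.C T.det := by
    rw [RingHom.map_det]; rfl
  rw [h1, Matrix.det_mul, h3]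
  congr 2
  rw [Matrix.det_of_isUpperTriangular]
  · rw [← Fin.prod_univ_eq_prod_range (fun k => c k * (newton z k).eval (z k) / c (d + k))]
    exact Equiv.prod_comp Fin.revPerm
      (fun i : Fin K => c i * (newton z i).eval (z i) / c (d + i))
  · intro i j hij
    simp only [T, Matrix.of_apply]
    have h4 : (i.rev : ℕ) < j.rev := Fin.rev_lt_rev.2 hij
    rw [eval_newton_eq_zero z h4, mul_zero, zero_div]

/-- The coefficients of `g_{K-j} F_N` in the basis `g_0, g_1, …`. -/
def mulCoeff {z c : ℕ → ℝ} (hz : StrictMono z) (hc : ∀ m, c m ≠ 0) {N : ℕ} (n : Fin N → ℕ)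
    (M d : ℕ) {K : ℕ} (j : Fin K) : ℕ →₀ ℝ :=
  (newtonBasis hz hc).repr (mulPoly z c n M d j.rev)

theorem exists_isExpansion {a b : ℝ} (ha : -1 < a) (hb : -1 < b) (hab : -1 ≤ a + b) {K d : ℕ}
    (hz : StrictMono (node (eps a b))) (hc : ∀ m, jacCoeff a m ≠ 0)
    (ν : PosSign (K + d)) {M : ℕ} (hM : ∀ i, ν.shifted i < M) (hNM : K + d ≤ M) :
    ∃ c : PosSign K →₀ ℝ, IsExpansion a b ν c ∧ ∀ κ, c κ = dFactor (eps a b) κ *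
      (Matrix.of fun i j : Fin K => mulCoeff hz hc ν.shifted M d j (κ.shifted i)).det := by
  classical
  set z := node (eps a b) with hz_def
  set c := jacCoeff a with hc_def
  set n := ν.shifted with hn_def
  let ρ : Fin K → ℕ →₀ ℝ := mulCoeff hz hc n M d
  -- A common bound for the `K` finite supports, so that Cauchy–Binet is a finite sum and only
  -- finitely many `κ` contribute.
  obtain ⟨n₀, hn₀⟩ : ∃ n₀, ∀ j m, n₀ ≤ m → ρ j m = 0 := by
    refine ⟨univ.sup (fun j => (ρ j).support.sup id) + 1, fun j m hm => ?_⟩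
    by_contra h
    have h1 : m ≤ (ρ j).support.sup id := le_sup (f := id) (Finsupp.mem_support_iff.2 h)
    have h2 := le_sup (f := fun j => (ρ j).support.sup id) (mem_univ j)
    omega
  let D : PosSign K → ℝ := fun κ => (Matrix.of fun i j : Fin K => ρ j (κ.shifted i)).det
  have hD : ∀ κ, dFactor (eps a b) κ * D κ ≠ 0 → κ ∈ boundedSign K n₀ := by
    intro κ h
    rw [mem_boundedSign]
    intro i
    by_contra hi
    push Not at hi
    exact h (by
      simp only [D]
      rw [Matrix.det_eq_zero_of_row_eq_zero i fun j => hn₀ j _ hi, mul_zero])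
  refine ⟨Finsupp.onFinset (boundedSign K n₀) (fun κ => dFactor (eps a b) κ * D κ) hD, ?_,
    fun κ => rfl⟩
  rw [IsExpansion, Finsupp.onFinset_sum _ fun κ => by simp]
  apply mul_left_cancel₀ (vandermondePoly_ne_zero K)
  rw [← restrictHom_apply, vandermondePoly_mul_restrictHom_normJacobi ha hb hab ν hM hNM, mul_sum]
  have hdet : (Matrix.of fun j l : Fin K =>
      Polynomial.aeval (MvPolynomial.X l : MvPolynomial (Fin K) ℝ)
        (mulPoly z c n M d j.rev)).det =
      ∑ κ ∈ boundedSign K n₀, MvPolynomial.C (D κ) * (newtonSumMatrix z c κ.shifted).det := by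
    have h1 := det_sum_mul_eq K n₀ (fun j m => (MvPolynomial.C (ρ j m) : MvPolynomial (Fin K) ℝ))
      (fun m l => Polynomial.aeval (MvPolynomial.X l : MvPolynomial (Fin K) ℝ) (newtonSum z c m))
    have h2 : ∀ j l : Fin K, ∑ m ∈ range n₀, MvPolynomial.C (ρ j m) *
        Polynomial.aeval (MvPolynomial.X l : MvPolynomial (Fin K) ℝ) (newtonSum z c m) =
        Polynomial.aeval (MvPolynomial.X l : MvPolynomial (Fin K) ℝ)
          (mulPoly z c n M d j.rev) := by
      intro j l
      rw [← (newtonBasis hz hc).linearCombination_repr (mulPoly z c n M d j.rev),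
        Finsupp.linearCombination_apply, Finsupp.sum_of_support_subset (s := range n₀), map_sum]
      · refine sum_congr rfl fun m _ => ?_
        rw [map_smul, newtonBasis_apply, MvPolynomial.smul_eq_C_mul]
        rfl
      · intro m hm
        rw [mem_range]
        by_contra h
        push Not at h
        exact Finsupp.mem_support_iff.1 hm (hn₀ j m h)
      · simp
    simp only [h2] at h1
    rw [h1]
    refine sum_congr rfl fun κ _ => ?_
    congr 1
    simp only [D, RingHom.map_det]
    rfl
  have hterm : ∀ κ ∈ boundedSign K n₀, vandermondePoly K *
      (MvPolynomial.C (dFactor (eps a b) κ * D κ) * normJacobi a b κ) =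
      MvPolynomial.C ((∏ k ∈ range K, (newton z k).eval (z k)) * ∏ q ∈ range K, c q)⁻¹ *
        (MvPolynomial.C (D κ) * (newtonSumMatrix z c κ.shifted).det) := by
    intro κ _
    rw [mul_left_comm, vandermondePoly_mul_normJacobi ha hb hab, ← mul_assoc, ← mul_assoc,
      ← map_mul, ← map_mul]
    congr 2
    rw [dFactor_eq]
    have h1 := nodeVandermonde_ne_zero hz κ.shifted_strictAnti.injective
    rw [← hz_def, ← hc_def, mul_inv, mul_inv]
    field_simp
  -- Both sides are now multiples of one flag determinant; the triangular factor of `det_mulPoly`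
  -- accounts for the difference of the constants.
  rw [sum_congr rfl hterm, ← mul_sum, ← hdet, det_mulPoly, ← mul_assoc, ← map_mul]
  congr 2
  have h1 : ∏ k ∈ range K, (newton z k).eval (z k) ≠ 0 :=
    prod_ne_zero_iff.2 fun k _ => eval_newton_self_ne_zero hz k
  have h2 : ∏ q ∈ range K, c q ≠ 0 := prod_ne_zero_iff.2 fun q _ => hc q
  rw [prod_div_distrib, prod_mul_distrib]
  simp only [add_comm d, ← hc_def]
  field_simp

theorem isExpansion_iff_of_exists {a b : ℝ} (ha : -1 < a) (hb : -1 < b) (hab : -1 ≤ a + b)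
    {N K : ℕ} {ν : PosSign N} (hex : ∃ c : PosSign K →₀ ℝ, IsExpansion a b ν c)
    (c : PosSign K →₀ ℝ) : IsExpansion a b ν c ↔ c = Lam a b K ν := by
  have h : IsExpansion a b ν (Lam a b K ν) := by
    rw [Lam, dif_pos hex]
    exact hex.choose_spec
  exact ⟨fun hc => isExpansion_unique ha hb hab hc h, fun hc => hc ▸ h⟩

/-! ### Passage to complex coefficients. -/

/-- The complex basis of the polynomials `newtonSum z c n`. -/
def newtonBasisComplex {z c : ℕ → ℝ} (hz : StrictMono z) (hc : ∀ m, c m ≠ 0) :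
    Module.Basis ℕ ℂ (Polynomial ℂ) :=
  Polynomial.Sequence.basis ⟨fun n => (newtonSum z c n).map Complex.ofRealHom, fun n => by
    rw [Polynomial.degree_map, degree_newtonSum hz hc]⟩ fun i =>
    isUnit_iff_ne_zero.2 (Polynomial.leadingCoeff_ne_zero.2 (Polynomial.Sequence.ne_zero _ i))

theorem newtonBasisComplex_apply {z c : ℕ → ℝ} (hz : StrictMono z) (hc : ∀ m, c m ≠ 0) (n : ℕ) :
    newtonBasisComplex hz hc n = (newtonSum z c n).map Complex.ofRealHom :=
  Polynomial.Sequence.basis_eq_self _ _ n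

theorem newtonBasisComplex_repr {z c : ℕ → ℝ} (hz : StrictMono z) (hc : ∀ m, c m ≠ 0)
    (p : Polynomial ℝ) (m : ℕ) :
    (newtonBasisComplex hz hc).repr (p.map Complex.ofRealHom) m =
      ((newtonBasis hz hc).repr p m : ℂ) := by
  conv_lhs => rw [← (newtonBasis hz hc).linearCombination_repr p,
    Finsupp.linearCombination_apply, Finsupp.sum, Polynomial.map_sum, map_sum]
  rw [Finsupp.finsetSum_apply]
  have : ∀ k, (newtonBasisComplex hz hc).repr
      (((newtonBasis hz hc).repr p k • newtonBasis hz hc k).map Complex.ofRealHom) m =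
      if k = m then ((newtonBasis hz hc).repr p k : ℂ) else 0 := by
    intro k
    rw [newtonBasis_apply, Polynomial.smul_eq_C_mul, Polynomial.map_mul, Polynomial.map_C,
      ← newtonBasisComplex_apply hz hc, ← Polynomial.smul_eq_C_mul, map_smul,
      Module.Basis.repr_self, Finsupp.smul_single, Finsupp.single_apply]
    simp
  rw [sum_congr rfl fun k _ => this k]
  by_cases hm : (newtonBasis hz hc).repr p m = 0 <;> simp [hm]

end JacobiBranching

end

open JacobiBranching in
theorem theoremB (a b : ℝ) (ha : -1 < a) (hb : -1 < b) (hab : -1 ≤ a + b)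
    (N K : ℕ) (hK : 1 ≤ K) (hKN : K < N) :
    (∀ (ν : PosSign N) (c : PosSign K →₀ ℝ), IsExpansion a b ν c ↔ c = Lam a b K ν) ∧
    ∃ B : Module.Basis ℕ ℂ (evenSpace (eps a b) (N - K + 1)),
      (∀ k, (B k : RatFunc ℂ) = gFun a (eps a b) (N - K + 1) k) ∧
      ∀ ν : PosSign N,
        ∃ hmem : ∀ j : Fin K, gFun a (eps a b) (N - K + 1) (j.rev : ℕ) * charFun (eps a b) ν ∈
            evenSpace (eps a b) (N - K + 1),
          ∀ κ : PosSign K,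
            ((Lam a b K ν κ / dFactor (eps a b) κ : ℝ) : ℂ) =
              (Matrix.of fun i j : Fin K =>
                B.repr ⟨gFun a (eps a b) (N - K + 1) (j.rev : ℕ) * charFun (eps a b) ν, hmem j⟩
                  (κ.shifted i)).det := by
  obtain ⟨d, rfl⟩ := Nat.exists_eq_add_of_lt hKN
  rw [show K + d + 1 = K + (d + 1) from rfl]
  -- From here `d` is `N - K`, so `L = d + 1`.
  generalize d + 1 = d
  rw [Nat.add_sub_cancel_left]
  have hε : 0 ≤ eps a b := by unfold eps; linarith
  have hz := node_strictMono hε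
  have hc : ∀ m, jacCoeff a m ≠ 0 := fun m => (jacCoeff_pos ha m).ne'
  have hbound : ∀ ν : PosSign (K + d), ∃ M, (∀ i, ν.shifted i < M) ∧ K + d ≤ M := fun ν =>
    ⟨Finset.univ.sup ν.shifted + 1 + (K + d), fun i => by
      have := Finset.le_sup (f := ν.shifted) (Finset.mem_univ i)
      omega, by omega⟩
  have hiff : ∀ (ν : PosSign (K + d)) (c : PosSign K →₀ ℝ),
      IsExpansion a b ν c ↔ c = Lam a b K ν := by
    intro ν
    obtain ⟨M, hM, hNM⟩ := hbound ν
    obtain ⟨c, hc, -⟩ := exists_isExpansion ha hb hab hz hc ν hM hNM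
    exact isExpansion_iff_of_exists ha hb hab ⟨c, hc⟩
  refine ⟨hiff, (newtonBasisComplex hz hc).map (evenEquiv hε hc d), fun k => ?_, fun ν => ?_⟩
  · rw [gFun_eq_realTrans ha hε, realTrans_apply, Module.Basis.map_apply, newtonBasisComplex_apply]
  obtain ⟨M, hM, hNM⟩ := hbound ν
  have hg : ∀ j : Fin K, gFun a (eps a b) (d + 1) (j.rev : ℕ) * charFun (eps a b) ν =
      evenEquiv hε hc d ((mulPoly (node (eps a b)) (jacCoeff a) ν.shifted M d j.rev).map
        Complex.ofRealHom) := fun j =>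
    gFun_mul_charFun ha hε (by have := j.rev.isLt; omega) ν hM hNM
  refine ⟨fun j => by rw [hg]; exact Subtype.property _, fun κ => ?_⟩
  obtain ⟨c, hexp, hcκ⟩ := exists_isExpansion ha hb hab hz hc ν hM hNM
  have hd : dFactor (eps a b) κ ≠ 0 := by
    rw [dFactor_eq]
    exact div_ne_zero (nodeVandermonde_ne_zero hz κ.shifted_strictAnti.injective)
      (Finset.prod_ne_zero_iff.2 fun k _ => eval_newton_self_ne_zero hz k)
  rw [← (hiff ν c).1 hexp, hcκ, mul_div_cancel_left₀ _ hd]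
  have hmap := Complex.ofRealHom.map_det
    (Matrix.of fun i j : Fin K => mulCoeff hz hc ν.shifted M d j (κ.shifted i))
  refine hmap.trans ?_
  congr 1
  ext1 i j
  -- The basis `B` is the image of the `Q_k`, so the coordinates of `g_{K-j} F_N` are those of its
  -- preimage `mulPoly`.
  have hsub : ∀ h, (⟨gFun a (eps a b) (d + 1) (j.rev : ℕ) * charFun (eps a b) ν, h⟩ :
      evenSpace (eps a b) (d + 1)) = evenEquiv hε hc d
        ((mulPoly (node (eps a b)) (jacCoeff a) ν.shifted M d j.rev).map Complex.ofRealHom) :=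
    fun h => Subtype.ext (hg j)
  rw [Matrix.of_apply, hsub, Module.Basis.map_repr, LinearEquiv.trans_apply,
    LinearEquiv.symm_apply_apply, newtonBasisComplex_repr]
  rfl
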